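/- Let $N\ge 3$ and let $\mathcal G$ be the star graph made of $N$ halflines $[0,+\infty)$ glued at their origins, at the vertex $\mathrm v$. A function on $\mathcal G$ is a vector $\Phi=(\Phi_1,\dots,\Phi_N)$ with $\Phi_j:[0,+\infty)\to\mathbb C$. Let $H^1(\mathcal G)$ be the set of $\Phi$ with $\Phi_j\in H^1(0,+\infty)$ for all $j$ and $\Phi_1(0)=\dots=\Phi_N(0)=:\Phi(\mathrm v)$, with norm $\|\Phi\|_{H^1(\mathcal G)}^2=\sum_{j}\big(\|\Phi_j\|_{L^2(0,\infty)}^2+\|\Phi_j'\|_{L^2(0,\infty)}^2\big)$. Let $0<\mu<2$, $\alpha>0$ and $$Q(\Phi)=\sum_{j=1}^N\|\Phi_j\|_{L^2(0,\infty)}^2,\qquad E(\Phi,\mathcal G)=\frac12\sum_{j=1}^N\|\Phi_j'\|_{L^2(0,\infty)}^2-\frac1{2\mu+2}\sum_{j=1}^N\|\Phi_j\|_{L^{2\mu+2}(0,\infty)}^{2\mu+2}-\frac\alpha2|\Phi(\mathrm v)|^2,$$ and $H^1_M(\mathcal G)=\{\Phi\in H^1(\mathcal G): Q(\Phi)=M\}$.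 For $\omega>\alpha^2/N^2$ let $\Psi_\omega$ be the symmetric state $$(\Psi_\omega)_j(x)=\phi_\omega(x+\zeta)\quad (j=1,\dots,N),\qquad \phi_\omega(x)=[(\mu+1)\omega]^{\frac1{2\mu}}\operatorname{sech}^{\frac1\mu}(\mu\sqrt\omega\,x),\qquad \zeta=\frac1{\mu\sqrt\omega}\operatorname{arctanh}\Big(\frac{\alpha}{N\sqrt\omega}\Big),$$ and let $M=Q(\Psi_\omega)$. Then $\Psi_\omega\in H^1_M(\mathcal G)$ is a strict, up to multiplication by a phase, local minimizer of $E(\cdot,\mathcal G)$ in $H^1_M(\mathcal G)$. That is, there is $\delta>0$ such that every $\Phi\in H^1_M(\mathcal G)$ with $\inf_{\theta\in\mathbb R}\|\Phi-e^{i\theta}\Psi_\omega\|_{H^1(\mathcal G)}<\delta$ and $\Phi\ne e^{i\theta}\Psi_\omega$ for all $\theta\in\mathbb R$ satisfies $$E(\Psi_\omega,\mathcal G)<E(\Phi,\mathcal G).$$ -/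

import Mathlib

open MeasureTheory Set

namespace StarGraph

/-- `g` is a weak derivative of `f` on the open halfline `(0, ∞)`. -/
def IsWeakDeriv (f g : ℝ → ℂ) : Prop :=
  ∀ φ : ℝ → ℝ, ContDiff ℝ ((⊤ : ℕ∞) : WithTop ℕ∞) φ → HasCompactSupport φ → tsupport φ ⊆ Ioi 0 →
    ∫ x in Ioi (0 : ℝ), deriv φ x • f x = -∫ x in Ioi (0 : ℝ), φ x • g x

/-- `f`, restricted to `[0, ∞)`, is (the continuous representative of) an element of
`H¹(0, ∞)`. Its values on the negative reals play no role. -/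
structure MemH1 (f : ℝ → ℂ) : Prop where
  continuousOn : ContinuousOn f (Ici 0)
  memLp : MemLp f 2 (volume.restrict (Ioi 0))
  exists_weakDeriv : ∃ g : ℝ → ℂ, MemLp g 2 (volume.restrict (Ioi 0)) ∧ IsWeakDeriv f g

open Classical in
/-- The weak derivative of `f` in `L²(0, ∞)`, which is unique almost everywhere when it exists
(and `0` when it does not). -/
noncomputable def weakDeriv (f : ℝ → ℂ) : ℝ → ℂ :=
  if h : ∃ g : ℝ → ℂ, MemLp g 2 (volume.restrict (Ioi 0)) ∧ IsWeakDeriv f g then h.choose else 0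

/-- The space `H¹(𝒢)` on the star graph with `N` halflines. A function on the graph is the vector
`Φ` of its components, each on `[0, ∞)`; the vertex is the point `0` of every edge. -/
structure MemH1Graph {N : ℕ} (Φ : Fin N → ℝ → ℂ) : Prop where
  memH1 : ∀ j, MemH1 (Φ j)
  continuous_vertex : ∀ i j, Φ i 0 = Φ j 0

/-- The norm of `H¹(𝒢)`. -/
noncomputable def h1Norm {N : ℕ} (Φ : Fin N → ℝ → ℂ) : ℝ :=
  √(∑ j, ((∫ x in Ioi (0 : ℝ), ‖Φ j x‖ ^ 2) + ∫ x in Ioi (0 : ℝ), ‖weakDeriv (Φ j) x‖ ^ 2))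

/-- The mass `Q(Φ) = ‖Φ‖²` in `L²(𝒢)`. -/
noncomputable def mass {N : ℕ} (Φ : Fin N → ℝ → ℂ) : ℝ :=
  ∑ j, ∫ x in Ioi (0 : ℝ), ‖Φ j x‖ ^ 2

/-- The constant-mass set `H¹_M(𝒢)`. -/
def H1M (N : ℕ) (M : ℝ) : Set (Fin N → ℝ → ℂ) :=
  {Φ | MemH1Graph Φ ∧ mass Φ = M}

/-- The value at the vertex (for `Φ` continuous at the vertex, every edge gives the same one). -/
def vertexValue {N : ℕ} [NeZero N] (Φ : Fin N → ℝ → ℂ) : ℂ := Φ 0 0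

/-- The energy `E(Φ, 𝒢)` with nonlinearity power `2μ + 1` and delta interaction of strength `-α`
at the vertex. -/
noncomputable def energy {N : ℕ} [NeZero N] (μ α : ℝ) (Φ : Fin N → ℝ → ℂ) : ℝ :=
  1 / 2 * (∑ j, ∫ x in Ioi (0 : ℝ), ‖weakDeriv (Φ j) x‖ ^ 2)
    - 1 / (2 * μ + 2) * (∑ j, ∫ x in Ioi (0 : ℝ), ‖Φ j x‖ ^ (2 * μ + 2))
    - α / 2 * ‖vertexValue Φ‖ ^ 2

/-- The soliton `φ_ω(x) = [(μ + 1) ω]^{1/(2μ)} sech^{1/μ}(μ √ω x)`. -/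
noncomputable def soliton (μ ω x : ℝ) : ℝ :=
  ((μ + 1) * ω) ^ (1 / (2 * μ)) * (1 / Real.cosh (μ * √ω * x)) ^ (1 / μ)

/-- The translation parameter `ζ = artanh(α / (N √ω)) / (μ √ω)`. -/
noncomputable def zeta (N : ℕ) (μ α ω : ℝ) : ℝ :=
  1 / (μ * √ω) * Real.artanh (α / (N * √ω))

/-- The symmetric state `Ψ_ω`, equal to `φ_ω(· + ζ)` on every edge. -/
noncomputable def Psi (N : ℕ) (μ α ω : ℝ) : Fin N → ℝ → ℂ :=
  fun _ x => (soliton μ ω (x + zeta N μ α ω) : ℂ)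

/-- Multiplication of `Φ` by the phase `e^{iθ}`. -/
noncomputable def phase {N : ℕ} (θ : ℝ) (Φ : Fin N → ℝ → ℂ) : Fin N → ℝ → ℂ :=
  fun j x => Complex.exp (θ * Complex.I) * Φ j x

end StarGraph

/-!
# Strict local minimality of the symmetric state on a star graph

Write `κ = α / N`. The proof completes a square. For `f ∈ H¹(0, ∞)` and a frequency `ω`, put
`k(s) = √(ω - s^μ / (μ + 1))`; the decreasing half-solitons of frequency `ω` solve
`f' = -k(|f|²) f`. As `2 k(|f|²) Re (f̄ f')` is an exact derivative and `f` vanishes at infinity,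
the action `½ ‖f'‖² - ‖f‖^{2μ+2} / (2μ + 2) + ω/2 ‖f‖²` equals
`½ ∫ |f' + k(|f|²) f|²` plus a function of `|f(0)|` alone (`MemH1.action_eq`), as soon as `|f|`
stays below the maximum `((μ + 1) ω)^{1/(2μ)}` of the soliton `φ_ω`.

The frequency is a free parameter here. For `Φ` near the orbit of `Ψ_ω`, take the `ω'` for which the
symmetric state `Ψ_ω'` has the vertex value of `Φ` in modulus, that is
`|Φ(v)|^{2μ} = (μ + 1) (ω' - κ²)`. The components of `Φ` then stay below the maximum of `φ_ω'`:
they are uniformly close to a half-soliton, which is largest at the vertex, and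
`(μ + 1) ω'` exceeds `|Φ(v)|^{2μ}` by the fixed amount `(μ + 1) κ²`. Hence, with `d(ω')` the action
of one edge of `Ψ_ω'`, vertex term included (`reducedAction`),
`E(Φ) + ω'/2 M = N d(ω') + a sum of squares`, and `E(Ψ_ω) + ω/2 M = N d(ω)`. No comparison between
the masses of the individual edges is needed.

Since `N d'` is half the mass of the symmetric state, which increases strictly with the frequency
when `μ < 2` (`strictMonoOn_tailMass`), the function `d` lies strictly above its tangent at `ω`
(`reducedAction_tangent_lt`), and `E(Φ) > E(Ψ_ω)` if `ω' ≠ ω`. If `ω' = ω` and `E(Φ) ≤ E(Ψ_ω)`, all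
the squares vanish, so that every component of `Φ` solves `f' = -k(|f|²) f` with
`|f(0)| = Ψ_ω(v)`; such solutions are unique up to a constant factor (`IsTail.div_eq_div`), which is
the phase of `Φ(v)`.
-/

namespace StarGraph

/-! ### Weak derivatives on the halfline -/

theorem exists_Icc_of_tsupport_subset {φ : ℝ → ℝ} (hc : HasCompactSupport φ)
    (hs : tsupport φ ⊆ Ioi 0) : ∃ a b : ℝ, 0 < a ∧ a < b ∧ ∀ x, x ∉ Icc a b → φ x = 0 := by
  have hK : IsCompact (tsupport φ) := hc
  have h0 : (tsupport φ)ᶜ ∈ nhds (0 : ℝ) :=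
    (isClosed_tsupport φ).isOpen_compl.mem_nhds fun h => lt_irrefl (0 : ℝ) (hs h)
  obtain ⟨a, ha, hball⟩ := Metric.mem_nhds_iff.1 h0
  obtain ⟨b, hb⟩ := hK.isBounded.subset_closedBall 0
  refine ⟨a, max b (a + 1), ha, lt_of_lt_of_le (by linarith) (le_max_right _ _), fun x hx => ?_⟩
  by_contra h
  have hxt : x ∈ tsupport φ := subset_tsupport _ h
  have hx0 : 0 < x := hs hxt
  refine hx ⟨?_, ?_⟩
  · by_contra hlt
    have hxb : x ∈ Metric.ball (0 : ℝ) a := by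
      rw [mem_ball_zero_iff, Real.norm_eq_abs, abs_of_pos hx0]
      exact not_le.1 hlt
    exact hball hxb hxt
  · have := hb hxt
    rw [mem_closedBall_zero_iff, Real.norm_eq_abs, abs_of_pos hx0] at this
    exact this.trans (le_max_left _ _)

theorem integrableOn_mul_of_tsupport_subset {φ u : ℝ → ℝ} (hφ : Continuous φ)
    (hc : HasCompactSupport φ) (hs : tsupport φ ⊆ Ioi 0) (hu : ContinuousOn u (Ici 0)) :
    IntegrableOn (fun x => φ x * u x) (Ioi 0) := by
  have hK : IsCompact (tsupport φ) := hc
  have h1 : IntegrableOn (fun x => φ x * u x) (tsupport φ) :=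
    (hφ.continuousOn.mul (hu.mono (hs.trans Ioi_subset_Ici_self))).integrableOn_compact hK
  refine IntegrableOn.mono_set ?_ (subset_univ _)
  rw [integrableOn_univ]
  refine (integrableOn_iff_integrable_of_support_subset fun x hx => ?_).1 h1
  exact subset_tsupport _ (left_ne_zero_of_mul hx)

/-- The du Bois-Reymond lemma: test functions of integral `0` are exactly the derivatives of test
functions, so `u` minus its average against a fixed normalized bump is orthogonal to every test
function. -/
theorem eq_of_integral_deriv_mul_eq_zero {u : ℝ → ℝ} (hu : ContinuousOn u (Ici 0))
    (h : ∀ φ : ℝ → ℝ, ContDiff ℝ ((⊤ : ℕ∞) : WithTop ℕ∞) φ → HasCompactSupport φ →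
      tsupport φ ⊆ Ioi 0 → ∫ x in Ioi (0 : ℝ), deriv φ x * u x = 0) {x : ℝ} (hx : 0 ≤ x) :
    u x = u 0 := by
  let B : ContDiffBump (2 : ℝ) := ⟨1 / 2, 1, by norm_num, by norm_num⟩
  set η : ℝ → ℝ := B.normed volume with hη
  have hηs : ContDiff ℝ ((⊤ : ℕ∞) : WithTop ℕ∞) η := B.contDiff_normed
  have hηc : HasCompactSupport η := B.hasCompactSupport_normed
  have hηt : tsupport η ⊆ Ioi 0 := by
    rw [hη, B.tsupport_normed_eq]
    intro y hy
    rw [Metric.mem_closedBall, Real.dist_eq, abs_le] at hy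
    have : B.rOut = 1 := rfl
    rw [this] at hy
    rw [mem_Ioi]
    linarith [hy.1]
  set c := ∫ x in Ioi (0 : ℝ), η x * u x with hcdef
  have key : ∀ᵐ y, y ∈ Ioi (0 : ℝ) → (fun y => u y - c) y = 0 := by
    refine isOpen_Ioi.ae_eq_zero_of_integral_contDiff_smul_eq_zero ?_ ?_
    · exact ((hu.mono Ioi_subset_Ici_self).sub continuousOn_const).locallyIntegrableOn
        measurableSet_Ioi
    intro ψ hψs hψc hψt
    obtain ⟨a₁, b₁, ha₁, hab₁, h₁⟩ := exists_Icc_of_tsupport_subset hψc hψt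
    obtain ⟨a₂, b₂, ha₂, hab₂, h₂⟩ := exists_Icc_of_tsupport_subset hηc hηt
    set m := ∫ y, ψ y with hm
    -- `θ` has integral `0`, so its primitive `P` from `0` is a test function on `(0, ∞)`.
    set θ : ℝ → ℝ := fun y => ψ y - m * η y with hθ
    have hθs : ContDiff ℝ ((⊤ : ℕ∞) : WithTop ℕ∞) θ := hψs.sub (contDiff_const.mul hηs)
    set a := min a₁ a₂
    set b := max b₁ b₂
    have ha : 0 < a := lt_min ha₁ ha₂
    have hθ0 : ∀ y, y ∉ Icc a b → θ y = 0 := by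
      intro y hy
      have e1 : ψ y = 0 := h₁ y fun H => hy
        ⟨(min_le_left _ _).trans H.1, H.2.trans (le_max_left _ _)⟩
      have e2 : η y = 0 := h₂ y fun H => hy
        ⟨(min_le_right _ _).trans H.1, H.2.trans (le_max_right _ _)⟩
      simp [hθ, e1, e2]
    have hψi : Integrable ψ := hψs.continuous.integrable_of_hasCompactSupport hψc
    have hηi : Integrable η := hηs.continuous.integrable_of_hasCompactSupport hηc
    have hθi : ∫ y, θ y = 0 := by
      rw [hθ, integral_sub hψi (hηi.const_mul m), integral_const_mul, hη, B.integral_normed]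
      simp [hm]
    set P : ℝ → ℝ := fun y => ∫ t in (0 : ℝ)..y, θ t with hP
    have hPd : ∀ y, HasDerivAt P (θ y) y := fun y =>
      (hθs.continuous.integral_hasStrictDerivAt 0 y).hasDerivAt
    have hPderiv : deriv P = θ := funext fun y => (hPd y).deriv
    have hPs : ContDiff ℝ ((⊤ : ℕ∞) : WithTop ℕ∞) P :=
      contDiff_infty_iff_deriv.2 ⟨fun y => (hPd y).differentiableAt, hPderiv ▸ hθs⟩
    have hP0 : ∀ y, y ∉ Icc a b → P y = 0 := by
      intro y hy
      by_cases hya : y < a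
      · refine (intervalIntegral.integral_congr (g := fun _ => (0 : ℝ))
          fun t ht => ?_).trans (by simp)
        refine hθ0 t fun H => ?_
        have := ht.2
        exact absurd H.1 (not_le.2 (this.trans_lt (max_lt ha hya)))
      · have hyb : b < y := by
          by_contra hby
          exact hy ⟨not_lt.1 hya, not_lt.1 hby⟩
        rw [hP]
        dsimp only
        rw [intervalIntegral.integral_of_le (by linarith [not_lt.1 hya])]
        refine Eq.trans ?_ hθi
        refine setIntegral_eq_integral_of_forall_compl_eq_zero fun t ht => hθ0 t fun H => ht ?_
        exact ⟨ha.trans_le H.1, H.2.trans hyb.le⟩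
    have hPts : tsupport P ⊆ Icc a b :=
      closure_minimal (fun y hy => by_contra fun H => hy (hP0 y H)) isClosed_Icc
    have hPc : HasCompactSupport P := isCompact_Icc.of_isClosed_subset (isClosed_tsupport P) hPts
    have h0 := h P hPs hPc (hPts.trans fun y hy => ha.trans_le hy.1)
    rw [hPderiv] at h0
    have i1 := integrableOn_mul_of_tsupport_subset hψs.continuous hψc hψt hu
    have i2 := integrableOn_mul_of_tsupport_subset hηs.continuous hηc hηt hu
    have e3 : ∫ x in Ioi (0 : ℝ), ψ x * u x = m * c := by
      have : ∫ x in Ioi (0 : ℝ), θ x * u x = (∫ x in Ioi (0 : ℝ), ψ x * u x) - m * c := by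
        rw [hcdef, ← integral_const_mul, ← integral_sub i1 (i2.const_mul m)]
        congr 1
        ext t
        simp only [hθ]
        ring
      linarith
    have e4 : ∫ x, ψ x • (u x - c) = ∫ x in Ioi (0 : ℝ), ψ x • (u x - c) := by
      refine (setIntegral_eq_integral_of_forall_compl_eq_zero fun t ht => ?_).symm
      rw [h₁ t fun H => ht (ha₁.trans_le H.1), zero_smul]
    have e5 : ∫ x in Ioi (0 : ℝ), ψ x = m :=
      setIntegral_eq_integral_of_forall_compl_eq_zero fun t ht =>
        h₁ t fun H => ht (ha₁.trans_le H.1)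
    rw [e4]
    simp only [smul_eq_mul, mul_sub]
    rw [integral_sub i1 (hψi.integrableOn.mul_const c), integral_mul_const, e3, e5, sub_self]
  have h1 : EqOn u (fun _ => c) (Ici 0) := by
    have hIoi : u =ᵐ[volume.restrict (Ioi 0)] fun _ => c := by
      refine (ae_restrict_iff' measurableSet_Ioi).2 ?_
      filter_upwards [key] with y hy hy0
      exact sub_eq_zero.1 (hy hy0)
    refine Measure.eqOn_of_ae_eq (μ := volume) ?_ hu continuousOn_const ?_
    · rwa [← restrict_Ioi_eq_restrict_Ici]
    · rw [interior_Ici, closure_Ioi]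
  rw [h1 hx, h1 (le_refl (0 : ℝ))]

/-- A continuous function with a locally integrable weak derivative is a primitive of it. -/
theorem eq_add_integral_of_integral_deriv_mul_eq_neg {u g : ℝ → ℝ} (hu : ContinuousOn u (Ici 0))
    (hg : ∀ R, 0 ≤ R → IntervalIntegrable g volume 0 R)
    (h : ∀ φ : ℝ → ℝ, ContDiff ℝ ((⊤ : ℕ∞) : WithTop ℕ∞) φ → HasCompactSupport φ →
      tsupport φ ⊆ Ioi 0 →
      ∫ x in Ioi (0 : ℝ), deriv φ x * u x = -∫ x in Ioi (0 : ℝ), φ x * g x)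
    {x : ℝ} (hx : 0 ≤ x) : u x = u 0 + ∫ t in (0 : ℝ)..x, g t := by
  set F : ℝ → ℝ := fun y => ∫ t in (0 : ℝ)..y, g t with hF
  have hFac : ∀ R, 0 ≤ R → AbsolutelyContinuousOnInterval F 0 R := fun R hR =>
    (hg R hR).absolutelyContinuousOnInterval_intervalIntegral left_mem_uIcc
  have hFc : ContinuousOn F (Ici 0) := by
    intro y hy
    have hy' : (0 : ℝ) ≤ y := hy
    have h1 := (hFac (y + 1) (by linarith)).continuousOn y
      (by rw [uIcc_of_le (by linarith)]; exact ⟨hy, by linarith⟩)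
    rw [uIcc_of_le (by linarith)] at h1
    refine h1.mono_of_mem_nhdsWithin ?_
    filter_upwards [self_mem_nhdsWithin, mem_nhdsWithin_of_mem_nhds (Iio_mem_nhds (lt_add_one y))]
      with z hz hz' using ⟨hz, hz'.le⟩
  have key := eq_of_integral_deriv_mul_eq_zero (hu.sub hFc) (fun φ hφ hφc hφt => ?_) hx
  · have : F 0 = 0 := by simp [hF]
    change u x - F x = u 0 - F 0 at key
    change u x = u 0 + F x
    linarith
  obtain ⟨a, b, ha, hab, h0⟩ := exists_Icc_of_tsupport_subset hφc hφt
  have hd0 : ∀ y, y ∉ Icc a b → deriv φ y = 0 := by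
    intro y hy
    have : φ =ᶠ[nhds y] fun _ => 0 := by
      filter_upwards [isClosed_Icc.isOpen_compl.mem_nhds hy] with z hz using h0 z hz
    rw [this.deriv_eq, deriv_const]
  have hd : Continuous (deriv φ) := hφ.continuous_deriv (by simp)
  have hdc : HasCompactSupport (deriv φ) := hφc.deriv
  have hdt : tsupport (deriv φ) ⊆ Ioi 0 := tsupport_deriv_subset.trans hφt
  have hb : 0 ≤ b := (ha.trans hab).le
  have hparts := AbsolutelyContinuousOnInterval.integral_deriv_mul_eq_sub
    ((hφ.of_le (by exact_mod_cast le_top)).contDiffOn.absolutelyContinuousOnInterval (a := 0)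
      (b := b + 1)) (hFac (b + 1) (by linarith))
  rw [h0 0 fun H => absurd H.1 (not_le.2 ha), h0 (b + 1) fun H => by linarith [H.2]] at hparts
  have hIb : IntervalIntegrable (fun y => deriv φ y * F y) volume 0 (b + 1) := by
    refine ContinuousOn.intervalIntegrable ?_
    rw [uIcc_of_le (by linarith)]
    exact hd.continuousOn.mul (hFc.mono Icc_subset_Ici_self)
  have hIg : IntervalIntegrable (fun y => φ y * g y) volume 0 (b + 1) :=
    (hg _ (by linarith)).continuousOn_mul hφ.continuous.continuousOn
  have hparts' : ∫ y in (0 : ℝ)..(b + 1), (deriv φ y * F y + φ y * g y) = 0 := by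
    rw [zero_mul, zero_mul, sub_zero] at hparts
    refine Eq.trans ?_ hparts
    refine intervalIntegral.integral_congr_ae ?_
    filter_upwards [(hg (b + 1) (by linarith)).ae_hasDerivAt_integral] with y hy hmem
    rw [(hy (uIoc_subset_uIcc hmem) 0 left_mem_uIcc).deriv]
  rw [intervalIntegral.integral_add hIb hIg] at hparts'
  have hswap : ∀ w : ℝ → ℝ, (∀ y, y ∉ Icc a b → w y = 0) →
      ∫ y in Ioi (0 : ℝ), w y = ∫ y in (0 : ℝ)..(b + 1), w y := by
    intro w hw
    rw [intervalIntegral.integral_of_le (by linarith)]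
    refine setIntegral_eq_of_subset_of_forall_sdiff_eq_zero measurableSet_Ioi
      (fun y hy => hy.1) fun y hy => hw y fun H => hy.2 ⟨hy.1, by linarith [H.2]⟩
  rw [← hswap _ fun y hy => by rw [hd0 y hy, zero_mul],
    ← hswap _ fun y hy => by rw [h0 y hy, zero_mul]] at hparts'
  have := h φ hφ hφc hφt
  have e : ∫ y in Ioi (0 : ℝ), deriv φ y * (u y - F y) =
      (∫ y in Ioi (0 : ℝ), deriv φ y * u y) - ∫ y in Ioi (0 : ℝ), deriv φ y * F y := by
    rw [← integral_sub (integrableOn_mul_of_tsupport_subset hd hdc hdt hu)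
      (integrableOn_mul_of_tsupport_subset hd hdc hdt hFc)]
    simp only [mul_sub]
  change ∫ y in Ioi (0 : ℝ), deriv φ y * (u y - F y) = 0
  linarith

/-! ### The space `H¹(0, ∞)` -/

theorem MemH1.memLp_weakDeriv {f : ℝ → ℂ} (hf : MemH1 f) :
    MemLp (weakDeriv f) 2 (volume.restrict (Ioi 0)) := by
  rw [weakDeriv, dif_pos hf.exists_weakDeriv]
  exact hf.exists_weakDeriv.choose_spec.1

theorem MemH1.isWeakDeriv {f : ℝ → ℂ} (hf : MemH1 f) : IsWeakDeriv f (weakDeriv f) := by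
  rw [weakDeriv, dif_pos hf.exists_weakDeriv]
  exact hf.exists_weakDeriv.choose_spec.2

theorem integrableOn_smul_of_memLp {φ : ℝ → ℝ} {f : ℝ → ℂ} (hφ : Continuous φ)
    (hc : HasCompactSupport φ) (hf : MemLp f 2 (volume.restrict (Ioi 0))) :
    IntegrableOn (fun x => φ x • f x) (Ioi 0) := by
  have h1 : MemLp φ 2 (volume.restrict (Ioi (0 : ℝ))) := hφ.memLp_of_hasCompactSupport hc
  exact memLp_one_iff_integrable.1 (hf.smul h1)

theorem IsWeakDeriv.sub_const_mul {f₁ g₁ f₂ g₂ : ℝ → ℂ} (c : ℂ) (h₁ : IsWeakDeriv f₁ g₁)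
    (h₂ : IsWeakDeriv f₂ g₂) (hf₁ : MemLp f₁ 2 (volume.restrict (Ioi 0)))
    (hf₂ : MemLp f₂ 2 (volume.restrict (Ioi 0))) (hg₁ : MemLp g₁ 2 (volume.restrict (Ioi 0)))
    (hg₂ : MemLp g₂ 2 (volume.restrict (Ioi 0))) :
    IsWeakDeriv (fun x => f₁ x - c * f₂ x) (fun x => g₁ x - c * g₂ x) := by
  intro φ hφ hc hs
  have hd : Continuous (deriv φ) := hφ.continuous_deriv (by simp)
  have e : ∀ (ψ : ℝ → ℝ) (u v : ℝ → ℂ), Continuous ψ → HasCompactSupport ψ →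
      MemLp u 2 (volume.restrict (Ioi 0)) → MemLp v 2 (volume.restrict (Ioi 0)) →
      ∫ x in Ioi (0 : ℝ), ψ x • (u x - c * v x) =
        (∫ x in Ioi (0 : ℝ), ψ x • u x) - c * ∫ x in Ioi (0 : ℝ), ψ x • v x := by
    intro ψ u v hψ hψc hu hv
    rw [← integral_const_mul, ← integral_sub (integrableOn_smul_of_memLp hψ hψc hu)
      ((integrableOn_smul_of_memLp hψ hψc hv).const_mul c)]
    congr 1
    ext x
    simp only [Complex.real_smul]
    ring
  rw [e _ _ _ hd hc.deriv hf₁ hf₂, e _ _ _ hφ.continuous hc hg₁ hg₂, h₁ φ hφ hc hs, h₂ φ hφ hc hs]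
  ring

theorem MemH1.sub_const_mul {f₁ f₂ : ℝ → ℂ} (c : ℂ) (h₁ : MemH1 f₁) (h₂ : MemH1 f₂) :
    MemH1 (fun x => f₁ x - c * f₂ x) where
  continuousOn := h₁.continuousOn.sub (continuousOn_const.mul h₂.continuousOn)
  memLp := h₁.memLp.sub (h₂.memLp.const_mul c)
  exists_weakDeriv := ⟨_, h₁.memLp_weakDeriv.sub (h₂.memLp_weakDeriv.const_mul c),
    h₁.isWeakDeriv.sub_const_mul c h₂.isWeakDeriv h₁.memLp h₂.memLp h₁.memLp_weakDeriv
      h₂.memLp_weakDeriv⟩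

theorem IsWeakDeriv.ae_eq {f g₁ g₂ : ℝ → ℂ} (h₁ : IsWeakDeriv f g₁) (h₂ : IsWeakDeriv f g₂)
    (hg₁ : MemLp g₁ 2 (volume.restrict (Ioi 0))) (hg₂ : MemLp g₂ 2 (volume.restrict (Ioi 0))) :
    g₁ =ᵐ[volume.restrict (Ioi 0)] g₂ := by
  have hsub := hg₁.sub hg₂
  have hloc : LocallyIntegrableOn (g₁ - g₂) (Ioi 0) volume :=
    locallyIntegrableOn_of_locallyIntegrable_restrict (hsub.locallyIntegrable (by norm_num))
  have key := isOpen_Ioi.ae_eq_zero_of_integral_contDiff_smul_eq_zero hloc fun φ hφ hc hs => by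
    have e : ∫ x, φ x • (g₁ - g₂) x = ∫ x in Ioi (0 : ℝ), φ x • (g₁ - g₂) x := by
      refine (setIntegral_eq_integral_of_forall_compl_eq_zero fun t ht => ?_).symm
      rw [image_eq_zero_of_notMem_tsupport fun H => ht (hs H), zero_smul]
    rw [e]
    simp only [Pi.sub_apply, smul_sub]
    rw [integral_sub (integrableOn_smul_of_memLp hφ.continuous hc hg₁)
      (integrableOn_smul_of_memLp hφ.continuous hc hg₂)]
    have e₁ := h₁ φ hφ hc hs
    have e₂ := h₂ φ hφ hc hs
    rw [e₁] at e₂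
    rw [neg_injective e₂, sub_self]
  refine (ae_restrict_iff' measurableSet_Ioi).2 ?_
  filter_upwards [key] with x hx hx0 using sub_eq_zero.1 (hx hx0)

theorem isWeakDeriv_of_hasDerivAt {f f' : ℝ → ℂ} (hf : ∀ x, HasDerivAt f (f' x) x)
    (hf' : Continuous f') : IsWeakDeriv f f' := by
  intro φ hφ hc hs
  have hfc : Continuous f := continuous_iff_continuousAt.2 fun x => (hf x).continuousAt
  have hd : Continuous (deriv φ) := hφ.continuous_deriv (by simp)
  have i1 : Integrable (fun x => φ x • f' x) :=
    (hφ.continuous.smul hf').integrable_of_hasCompactSupport hc.smul_right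
  have i2 : Integrable (fun x => deriv φ x • f x) :=
    (hd.smul hfc).integrable_of_hasCompactSupport hc.deriv.smul_right
  obtain ⟨a, b, ha, hab, h0⟩ := exists_Icc_of_tsupport_subset hc hs
  have hderiv : ∀ x, HasDerivAt (fun x => φ x • f x) (φ x • f' x + deriv φ x • f x) x := fun x =>
    ((hφ.differentiable (by simp)) x).hasDerivAt.smul (hf x)
  have := integral_Ioi_of_hasDerivAt_of_tendsto (a := 0) (m := 0)
    (hderiv 0).continuousAt.continuousWithinAt (fun x _ => hderiv x) (i1.add i2).integrableOn
    (by
      refine tendsto_const_nhds.congr' ?_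
      filter_upwards [Filter.eventually_gt_atTop b] with x hx
      rw [h0 x fun H => absurd H.2 (not_le.2 hx), zero_smul])
  rw [h0 0 fun H => absurd H.1 (not_le.2 ha), zero_smul, sub_zero,
    integral_add i1.integrableOn i2.integrableOn, add_comm] at this
  exact eq_neg_of_add_eq_zero_left this

theorem intervalIntegrable_of_memLp_two {E : Type*} [NormedAddCommGroup E] {g : ℝ → E}
    (hg : MemLp g 2 (volume.restrict (Ioi 0))) {R : ℝ} (hR : 0 ≤ R) :
    IntervalIntegrable g volume 0 R := by
  rw [intervalIntegrable_iff_integrableOn_Ioc_of_le hR]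
  have h1 : MemLp g 2 (volume.restrict (Ioc 0 R)) :=
    hg.mono_measure (Measure.restrict_mono (fun x hx => hx.1) le_rfl)
  exact h1.integrable (by norm_num)

theorem MemH1.apply_eq_add_integral {f : ℝ → ℂ} (hf : MemH1 f) (L : ℂ →L[ℝ] ℝ) {x : ℝ}
    (hx : 0 ≤ x) : L (f x) = L (f 0) + ∫ t in (0 : ℝ)..x, L (weakDeriv f t) := by
  have hg := hf.memLp_weakDeriv
  refine eq_add_integral_of_integral_deriv_mul_eq_neg (u := fun x => L (f x))
    (g := fun x => L (weakDeriv f x)) (L.continuous.comp_continuousOn hf.continuousOn)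
    (fun R hR => ?_) (fun φ hφ hc hs => ?_) hx
  · have h1 := intervalIntegrable_of_memLp_two hg hR
    rw [intervalIntegrable_iff_integrableOn_Ioc_of_le hR] at h1 ⊢
    exact L.integrable_comp h1
  have hd : Continuous (deriv φ) := hφ.continuous_deriv (by simp)
  have := congrArg L (hf.isWeakDeriv φ hφ hc hs)
  rw [map_neg, ← L.integral_comp_comm (integrableOn_smul_of_memLp hd hc.deriv hf.memLp),
    ← L.integral_comp_comm (integrableOn_smul_of_memLp hφ.continuous hc hg)] at this
  simpa only [map_smul, smul_eq_mul] using this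

theorem _root_.LipschitzWith.comp_absolutelyContinuousOnInterval {H q : ℝ → ℝ} {K : NNReal}
    {a b : ℝ} (hH : LipschitzWith K H) (hq : AbsolutelyContinuousOnInterval q a b) :
    AbsolutelyContinuousOnInterval (fun x => H (q x)) a b := by
  unfold AbsolutelyContinuousOnInterval at hq ⊢
  have h2 := hq.const_mul (K : ℝ)
  rw [mul_zero] at h2
  refine squeeze_zero (fun E => Finset.sum_nonneg fun i _ => dist_nonneg) (fun E => ?_) h2
  rw [Finset.mul_sum]
  exact Finset.sum_le_sum fun i _ => hH.dist_le_mul _ _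

theorem _root_.AbsolutelyContinuousOnInterval.congr {u v : ℝ → ℝ} {a b : ℝ}
    (hu : AbsolutelyContinuousOnInterval u a b) (huv : EqOn u v (uIcc a b)) :
    AbsolutelyContinuousOnInterval v a b := by
  rw [absolutelyContinuousOnInterval_iff] at hu ⊢
  intro ε hε
  obtain ⟨δ, hδ, h⟩ := hu ε hε
  refine ⟨δ, hδ, fun E hE hlt => ?_⟩
  convert h E hE hlt using 2
  rename_i i hi
  have := hE.1 i hi
  rw [huv this.1, huv this.2]

/-- The chain rule for `H(|f|²)`, where `f ∈ H¹(0, ∞)` is only absolutely continuous. -/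
theorem MemH1.integral_comp_normSq {f : ℝ → ℂ} (hf : MemH1 f) {H h : ℝ → ℝ} {K : NNReal}
    (hH : ∀ s, HasDerivAt H (h s) s) (hK : LipschitzWith K H) {R : ℝ} (hR : 0 ≤ R) :
    ∫ x in (0 : ℝ)..R, h (‖f x‖ ^ 2) * (2 * inner ℝ (f x) (weakDeriv f x)) =
      H (‖f R‖ ^ 2) - H (‖f 0‖ ^ 2) := by
  have hint : ∀ L : ℂ →L[ℝ] ℝ, IntervalIntegrable (fun t => L (weakDeriv f t)) volume 0 R := by
    intro L
    have h1 := intervalIntegrable_of_memLp_two hf.memLp_weakDeriv hR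
    rw [intervalIntegrable_iff_integrableOn_Ioc_of_le hR] at h1 ⊢
    exact L.integrable_comp h1
  have hac : ∀ L : ℂ →L[ℝ] ℝ, AbsolutelyContinuousOnInterval (fun x => L (f x)) 0 R := by
    intro L
    have h1 := (hint L).absolutelyContinuousOnInterval_intervalIntegral (c := 0) left_mem_uIcc
    have h2 : AbsolutelyContinuousOnInterval (fun _ : ℝ => L (f 0)) 0 R :=
      contDiffOn_const.absolutelyContinuousOnInterval
    refine (h2.add h1).congr fun x hx => ?_
    rw [uIcc_of_le hR] at hx
    exact (hf.apply_eq_add_integral L hx.1).symm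
  have hder : ∀ L : ℂ →L[ℝ] ℝ, ∀ᵐ x, x ∈ Ioo 0 R →
      HasDerivAt (fun x => L (f x)) (L (weakDeriv f x)) x := by
    intro L
    filter_upwards [(hint L).ae_hasDerivAt_integral] with x hx hmem
    have h1 := (hx (by rw [uIcc_of_le hR]; exact Ioo_subset_Icc_self hmem) 0
      left_mem_uIcc).const_add (L (f 0))
    refine h1.congr_of_eventuallyEq ?_
    filter_upwards [Ioo_mem_nhds hmem.1 hmem.2] with y hy
    exact hf.apply_eq_add_integral L hy.1.le
  have hq : AbsolutelyContinuousOnInterval (fun x => ‖f x‖ ^ 2) 0 R := by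
    have hre := hac Complex.reCLM
    have him := hac Complex.imCLM
    refine ((hre.fun_mul hre).add (him.fun_mul him)).congr fun x _ => ?_
    simp only [Pi.add_apply, Complex.reCLM_apply, Complex.imCLM_apply]
    rw [Complex.sq_norm, Complex.normSq_apply]
  rw [← (hK.comp_absolutelyContinuousOnInterval hq).integral_deriv_eq_sub]
  refine intervalIntegral.integral_congr_ae ?_
  have hne : ∀ᵐ x : ℝ, x ≠ R := by simp [ae_iff, measure_singleton]
  filter_upwards [hder Complex.reCLM, hder Complex.imCLM, hne] with x hre him hxR hmem
  rw [uIoc_of_le hR] at hmem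
  have hx : x ∈ Ioo 0 R := ⟨hmem.1, lt_of_le_of_ne hmem.2 hxR⟩
  have d1 := hre hx
  have d2 := him hx
  simp only [Complex.reCLM_apply, Complex.imCLM_apply] at d1 d2
  have d3 : HasDerivAt (fun x => ‖f x‖ ^ 2) (2 * inner ℝ (f x) (weakDeriv f x)) x := by
    have := (d1.mul d1).add (d2.mul d2)
    refine (this.congr_deriv ?_).congr_of_eventuallyEq (Filter.Eventually.of_forall fun y => ?_)
    · rw [Complex.inner]
      simp only [Complex.mul_re, Complex.conj_re, Complex.conj_im]
      ring
    · simp only [Pi.add_apply, Pi.mul_apply]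
      rw [Complex.sq_norm, Complex.normSq_apply]
  exact ((hH _).comp x d3).deriv.symm

theorem integrable_norm_sq_of_memLp {E : Type*} [NormedAddCommGroup E] {ν : Measure ℝ} {f : ℝ → E}
    (hf : MemLp f 2 ν) : Integrable (fun x => ‖f x‖ ^ 2) ν :=
  (memLp_two_iff_integrable_sq_norm hf.1).1 hf

theorem integrable_inner_of_memLp {ν : Measure ℝ} {f g : ℝ → ℂ} (hf : MemLp f 2 ν)
    (hg : MemLp g 2 ν) : Integrable (fun x => inner ℝ (f x) (g x)) ν := by
  refine ((integrable_norm_sq_of_memLp hf).add (integrable_norm_sq_of_memLp hg)).mono'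
    (hf.1.inner hg.1) (Filter.Eventually.of_forall fun x => ?_)
  have := abs_real_inner_le_norm (f x) (g x)
  simp only [Pi.add_apply, Real.norm_eq_abs]
  nlinarith [sq_nonneg (‖f x‖ - ‖g x‖), sq_nonneg (‖f x‖), sq_nonneg (‖g x‖)]

theorem MemH1.integral_normSq {f : ℝ → ℂ} (hf : MemH1 f) {R : ℝ} (hR : 0 ≤ R) :
    ∫ x in (0 : ℝ)..R, 2 * inner ℝ (f x) (weakDeriv f x) = ‖f R‖ ^ 2 - ‖f 0‖ ^ 2 := by
  simpa using hf.integral_comp_normSq (H := id) (h := fun _ => 1) (fun s => hasDerivAt_id s)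
    LipschitzWith.id hR

theorem MemH1.tendsto_normSq {f : ℝ → ℂ} (hf : MemH1 f) :
    Filter.Tendsto (fun x => ‖f x‖ ^ 2) Filter.atTop (nhds 0) := by
  have hi : IntegrableOn (fun x => 2 * inner ℝ (f x) (weakDeriv f x)) (Ioi 0) :=
    (integrable_inner_of_memLp hf.memLp hf.memLp_weakDeriv).const_mul 2
  have h1 := (intervalIntegral_tendsto_integral_Ioi 0 hi Filter.tendsto_id).const_add (‖f 0‖ ^ 2)
  have h2 : Filter.Tendsto (fun x => ‖f x‖ ^ 2) Filter.atTop
      (nhds (‖f 0‖ ^ 2 + ∫ x in Ioi (0 : ℝ), 2 * inner ℝ (f x) (weakDeriv f x))) := by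
    refine h1.congr' ?_
    filter_upwards [Filter.eventually_ge_atTop 0] with x hx
    rw [id, hf.integral_normSq hx]
    ring
  have h3 : IntegrableAtFilter (fun x => ‖f x‖ ^ 2) Filter.atTop volume :=
    ⟨Ioi 0, Filter.Ioi_mem_atTop 0, integrable_norm_sq_of_memLp hf.memLp⟩
  have h4 := h3.eq_zero_of_tendsto (fun s hs => ?_) h2
  · rwa [h4] at h2
  · obtain ⟨a, ha⟩ := Filter.mem_atTop_sets.1 hs
    exact top_le_iff.1 (Real.volume_Ici (a := a) ▸ measure_mono fun y hy => ha y hy)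

/-- The Sobolev embedding `H¹(0, ∞) ⊆ L^∞`. -/
theorem MemH1.norm_sq_le {f : ℝ → ℂ} (hf : MemH1 f) {x : ℝ} (hx : 0 ≤ x) :
    ‖f x‖ ^ 2 ≤ (∫ t in Ioi (0 : ℝ), ‖f t‖ ^ 2) + ∫ t in Ioi (0 : ℝ), ‖weakDeriv f t‖ ^ 2 := by
  have hif := integrable_norm_sq_of_memLp hf.memLp
  have hig := integrable_norm_sq_of_memLp hf.memLp_weakDeriv
  have hadd : IntegrableOn (fun t => ‖f t‖ ^ 2 + ‖weakDeriv f t‖ ^ 2) (Ioi 0) := hif.add hig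
  rw [← integral_add hif hig]
  have hev : ∀ᶠ R in Filter.atTop, ‖f x‖ ^ 2 - ‖f R‖ ^ 2 ≤
      ∫ t in Ioi (0 : ℝ), (‖f t‖ ^ 2 + ‖weakDeriv f t‖ ^ 2) := by
    filter_upwards [Filter.eventually_ge_atTop x] with R hR
    have hi : ∀ y, 0 ≤ y → IntervalIntegrable
        (fun x => 2 * inner ℝ (f x) (weakDeriv f x)) volume 0 y := fun y hy => by
      rw [intervalIntegrable_iff_integrableOn_Ioc_of_le hy]
      exact IntegrableOn.mono_set
        ((integrable_inner_of_memLp hf.memLp hf.memLp_weakDeriv).const_mul 2) fun z hz => hz.1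
    have e1 : ‖f x‖ ^ 2 - ‖f R‖ ^ 2 = ∫ t in x..R, -(2 * inner ℝ (f t) (weakDeriv f t)) := by
      rw [intervalIntegral.integral_neg, ← intervalIntegral.integral_interval_sub_left
        (hi R (hx.trans hR)) (hi x hx), hf.integral_normSq (hx.trans hR), hf.integral_normSq hx]
      ring
    have hsub : Ioc x R ⊆ Ioi 0 := fun z hz => hx.trans_lt hz.1
    rw [e1, intervalIntegral.integral_of_le hR]
    calc ∫ t in Ioc x R, -(2 * inner ℝ (f t) (weakDeriv f t))
        ≤ ∫ t in Ioc x R, (‖f t‖ ^ 2 + ‖weakDeriv f t‖ ^ 2) := by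
          refine integral_mono (IntegrableOn.mono_set
            ((integrable_inner_of_memLp hf.memLp hf.memLp_weakDeriv).const_mul 2).neg hsub)
            (IntegrableOn.mono_set (hif.add hig) hsub) fun t => ?_
          have := neg_le_of_abs_le (abs_real_inner_le_norm (f t) (weakDeriv f t))
          dsimp only
          nlinarith [sq_nonneg (‖f t‖ - ‖weakDeriv f t‖)]
      _ ≤ _ := setIntegral_mono_set hadd
          (Filter.Eventually.of_forall fun t => by simp only [Pi.zero_apply]; positivity)
          (LE.le.eventuallyLE hsub)
  have hlim : Filter.Tendsto (fun R => ‖f x‖ ^ 2 - ‖f R‖ ^ 2) Filter.atTop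
      (nhds (‖f x‖ ^ 2 - 0)) := hf.tendsto_normSq.const_sub _
  rw [sub_zero] at hlim
  exact le_of_tendsto hlim hev

/-! ### Completing the square -/

/-- The rate `k(s) = √(ω - s^μ / (μ + 1))` at which a decreasing solution of
`f'' = ω f - |f|^{2μ} f` vanishing at infinity decays where `|f|² = s`: such an `f` satisfies
`f' = -k(|f|²) f`. The absolute value and the square root only serve to make `k` continuous on all
of `ℝ`. -/
noncomputable def decayRate (μ ω s : ℝ) : ℝ := √(ω - |s| ^ μ / (μ + 1))

/-- The least action on the halfline of the functions that stay below the maximum of the soliton and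
have squared modulus `s` at the origin. -/
noncomputable def tailAction (μ ω s : ℝ) : ℝ := ∫ σ in (0 : ℝ)..s, 1 / 2 * decayRate μ ω σ

theorem decayRate_nonneg (μ ω s : ℝ) : 0 ≤ decayRate μ ω s := Real.sqrt_nonneg _

theorem continuous_decayRate {μ : ℝ} (hμ : 0 < μ) (ω : ℝ) : Continuous (decayRate μ ω) := by
  unfold decayRate
  exact (continuous_const.sub ((continuous_abs.rpow_const fun _ => Or.inr hμ.le).div_const _)).sqrt

theorem decayRate_le {μ : ℝ} (hμ : 0 < μ) (ω s : ℝ) : decayRate μ ω s ≤ √ω := by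
  refine Real.sqrt_le_sqrt ?_
  have : 0 ≤ |s| ^ μ / (μ + 1) := by positivity
  linarith

theorem hasDerivAt_tailAction {μ : ℝ} (hμ : 0 < μ) (ω s : ℝ) :
    HasDerivAt (tailAction μ ω) (1 / 2 * decayRate μ ω s) s :=
  (((continuous_decayRate hμ ω).const_mul (1 / 2)).integral_hasStrictDerivAt 0 s).hasDerivAt

theorem tailAction_zero (μ ω : ℝ) : tailAction μ ω 0 = 0 := by simp [tailAction]

theorem lipschitzWith_tailAction {μ : ℝ} (hμ : 0 < μ) (ω : ℝ) :
    LipschitzWith (Real.toNNReal √ω) (tailAction μ ω) := by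
  refine lipschitzWith_of_nnnorm_deriv_le
    (fun s => (hasDerivAt_tailAction hμ ω s).differentiableAt) fun s => ?_
  rw [(hasDerivAt_tailAction hμ ω s).deriv, ← NNReal.coe_le_coe, coe_nnnorm, Real.norm_eq_abs,
    Real.coe_toNNReal _ (Real.sqrt_nonneg _), abs_of_nonneg (by
      have := decayRate_nonneg μ ω s; positivity)]
  have := decayRate_le hμ ω s
  have := decayRate_nonneg μ ω s
  linarith

theorem MemH1.memLp_decayRate_mul {f : ℝ → ℂ} (hf : MemH1 f) {μ : ℝ} (hμ : 0 < μ) (ω : ℝ) :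
    MemLp (fun x => decayRate μ ω (‖f x‖ ^ 2) • f x) 2 (volume.restrict (Ioi 0)) := by
  refine (hf.memLp.const_mul (√ω : ℂ)).mono ?_ (Filter.Eventually.of_forall fun x => ?_)
  · exact ((continuous_decayRate hμ ω).comp_aestronglyMeasurable (hf.memLp.1.norm.pow 2)).smul
      hf.memLp.1
  · rw [norm_smul, norm_mul, Real.norm_of_nonneg (decayRate_nonneg _ _ _), Complex.norm_real,
      Real.norm_of_nonneg (Real.sqrt_nonneg _)]
    exact mul_le_mul_of_nonneg_right (decayRate_le hμ _ _) (norm_nonneg _)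

theorem MemH1.integral_inner_eq_neg_tailAction {f : ℝ → ℂ} (hf : MemH1 f) {μ : ℝ} (hμ : 0 < μ)
    (ω : ℝ) : ∫ x in Ioi (0 : ℝ), inner ℝ (weakDeriv f x) (decayRate μ ω (‖f x‖ ^ 2) • f x) =
      -tailAction μ ω (‖f 0‖ ^ 2) := by
  have hi := integrable_inner_of_memLp hf.memLp_weakDeriv (hf.memLp_decayRate_mul hμ ω)
  have h1 := intervalIntegral_tendsto_integral_Ioi 0 hi Filter.tendsto_id
  have h2 : Filter.Tendsto (fun R => tailAction μ ω (‖f R‖ ^ 2) - tailAction μ ω (‖f 0‖ ^ 2))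
      Filter.atTop (nhds (tailAction μ ω 0 - tailAction μ ω (‖f 0‖ ^ 2))) :=
    (((hasDerivAt_tailAction hμ ω 0).continuousAt.tendsto.comp hf.tendsto_normSq)).sub_const _
  rw [tailAction_zero, zero_sub] at h2
  refine tendsto_nhds_unique h1 (h2.congr' ?_)
  filter_upwards [Filter.eventually_ge_atTop 0] with R hR
  rw [id, ← hf.integral_comp_normSq (hasDerivAt_tailAction hμ ω) (lipschitzWith_tailAction hμ ω) hR]
  congr 1
  ext x
  rw [inner_smul_right, real_inner_comm]
  ring

/-- The action of `f` is the least action for its value at the origin, plus the square of the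
distance of `f` from solving `f' = -k(|f|²) f`. -/
theorem MemH1.action_eq {f : ℝ → ℂ} (hf : MemH1 f) {μ ω : ℝ} (hμ : 0 < μ)
    (hb : ∀ x, 0 < x → (‖f x‖ ^ 2) ^ μ ≤ (μ + 1) * ω) :
    1 / 2 * (∫ x in Ioi (0 : ℝ), ‖weakDeriv f x‖ ^ 2)
        - 1 / (2 * μ + 2) * (∫ x in Ioi (0 : ℝ), ‖f x‖ ^ (2 * μ + 2))
        + ω / 2 * (∫ x in Ioi (0 : ℝ), ‖f x‖ ^ 2) =
      1 / 2 * (∫ x in Ioi (0 : ℝ), ‖weakDeriv f x + decayRate μ ω (‖f x‖ ^ 2) • f x‖ ^ 2)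
        + tailAction μ ω (‖f 0‖ ^ 2) := by
  have hif := integrable_norm_sq_of_memLp hf.memLp
  have hig := integrable_norm_sq_of_memLp hf.memLp_weakDeriv
  have hik := integrable_norm_sq_of_memLp (hf.memLp_decayRate_mul hμ ω)
  have hinn := integrable_inner_of_memLp hf.memLp_weakDeriv (hf.memLp_decayRate_mul hμ ω)
  have hpow : ∀ x, ‖f x‖ ^ (2 * μ + 2) = (‖f x‖ ^ 2) ^ μ * ‖f x‖ ^ 2 := by
    intro x
    rw [← Real.rpow_natCast, ← Real.rpow_mul (norm_nonneg _),
      Real.rpow_add_of_nonneg (norm_nonneg _) (by positivity) (by norm_num)]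
    norm_num
  have hip : IntegrableOn (fun x => ‖f x‖ ^ (2 * μ + 2)) (Ioi 0) := by
    refine (hif.const_mul ((μ + 1) * ω)).mono'
      (hf.memLp.1.norm.aemeasurable.pow_const _).aestronglyMeasurable ?_
    refine (ae_restrict_iff' measurableSet_Ioi).2 (Filter.Eventually.of_forall fun x hx => ?_)
    rw [Real.norm_of_nonneg (by positivity), hpow]
    exact mul_le_mul_of_nonneg_right (hb x hx) (by positivity)
  have e1 : ∫ x in Ioi (0 : ℝ), ‖decayRate μ ω (‖f x‖ ^ 2) • f x‖ ^ 2 =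
      ω * (∫ x in Ioi (0 : ℝ), ‖f x‖ ^ 2)
        - 1 / (μ + 1) * ∫ x in Ioi (0 : ℝ), ‖f x‖ ^ (2 * μ + 2) := by
    rw [← integral_const_mul, ← integral_const_mul,
      ← integral_sub (hif.const_mul ω) (hip.const_mul _)]
    refine setIntegral_congr_fun measurableSet_Ioi fun x hx => ?_
    have h0 : 0 ≤ ω - |‖f x‖ ^ 2| ^ μ / (μ + 1) := by
      rw [abs_of_nonneg (by positivity), sub_nonneg, div_le_iff₀ (by positivity), mul_comm]
      exact hb x hx
    rw [norm_smul, mul_pow, Real.norm_eq_abs, sq_abs, decayRate, Real.sq_sqrt h0, hpow,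
      abs_of_nonneg (by positivity)]
    ring
  have e2 : ∫ x in Ioi (0 : ℝ), ‖weakDeriv f x + decayRate μ ω (‖f x‖ ^ 2) • f x‖ ^ 2 =
      (∫ x in Ioi (0 : ℝ), ‖weakDeriv f x‖ ^ 2) + 2 * (-tailAction μ ω (‖f 0‖ ^ 2))
        + ∫ x in Ioi (0 : ℝ), ‖decayRate μ ω (‖f x‖ ^ 2) • f x‖ ^ 2 := by
    have hsum : IntegrableOn (fun x => ‖weakDeriv f x‖ ^ 2 +
        2 * inner ℝ (weakDeriv f x) (decayRate μ ω (‖f x‖ ^ 2) • f x)) (Ioi 0) :=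
      hig.add (hinn.const_mul 2)
    rw [← hf.integral_inner_eq_neg_tailAction hμ ω, ← integral_const_mul,
      ← integral_add hig (hinn.const_mul 2), ← integral_add hsum hik]
    congr 1
    ext x
    exact norm_add_sq_real _ _
  rw [e2, e1]
  have : μ + 1 ≠ 0 := by positivity
  field_simp
  ring

/-! ### Solutions of the first-order profile equation -/

/-- `f` solves `f' = -k(|f|²) f` on the halfline. -/
structure IsTail (μ ω : ℝ) (f : ℝ → ℂ) : Prop where
  continuousOn : ContinuousOn f (Ici 0)
  hasDerivAt : ∀ x, 0 < x → HasDerivAt f (-(decayRate μ ω (‖f x‖ ^ 2) • f x)) x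

theorem MemH1.isTail {f : ℝ → ℂ} (hf : MemH1 f) {μ ω : ℝ} (hμ : 0 < μ)
    (h : ∀ᵐ x ∂volume.restrict (Ioi 0),
      weakDeriv f x + decayRate μ ω (‖f x‖ ^ 2) • f x = 0) : IsTail μ ω f where
  continuousOn := hf.continuousOn
  hasDerivAt x hx := by
    set G : ℝ → ℂ := fun x => -(decayRate μ ω (‖f x‖ ^ 2) • f x) with hG
    have hGc : ContinuousOn G (Ici 0) :=
      (((continuous_decayRate hμ ω).comp_continuousOn (hf.continuousOn.norm.pow 2)).smul
        hf.continuousOn).neg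
    have hd : ∀ L : ℂ →L[ℝ] ℝ, HasDerivAt (fun x => L (f x)) (L (G x)) x := by
      intro L
      have hLc : ContinuousOn (fun x => L (G x)) (Ici 0) := L.continuous.comp_continuousOn hGc
      have h1 : HasDerivAt (fun y => ∫ t in (0 : ℝ)..y, L (G t)) (L (G x)) x := by
        refine intervalIntegral.integral_hasDerivAt_right ?_ ?_
          (hLc.continuousAt (Ici_mem_nhds hx))
        · refine ContinuousOn.intervalIntegrable ?_
          rw [uIcc_of_le hx.le]
          exact hLc.mono Icc_subset_Ici_self
        · exact (hLc.mono Ioi_subset_Ici_self).stronglyMeasurableAtFilter isOpen_Ioi x hx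
      refine (h1.const_add (L (f 0))).congr_of_eventuallyEq ?_
      filter_upwards [Ioi_mem_nhds hx] with y hy
      rw [hf.apply_eq_add_integral L (le_of_lt hy)]
      congr 1
      refine intervalIntegral.integral_congr_ae ?_
      filter_upwards [(ae_restrict_iff' measurableSet_Ioi).1 h] with t ht hmem
      rw [uIoc_of_le (le_of_lt hy)] at hmem
      rw [hG, eq_neg_of_add_eq_zero_left (ht hmem.1)]
    have h2 := (hd Complex.reCLM).ofReal_comp.add
      ((hd Complex.imCLM).ofReal_comp.mul_const Complex.I)
    refine (h2.congr_deriv ?_).congr_of_eventuallyEq (Filter.Eventually.of_forall fun y => ?_)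
    · exact Complex.re_add_im (G x)
    · exact (Complex.re_add_im _).symm

namespace IsTail

variable {μ ω : ℝ} {f : ℝ → ℂ}

theorem hasDerivAt_normSq (hf : IsTail μ ω f) {x : ℝ} (hx : 0 < x) :
    HasDerivAt (fun x => ‖f x‖ ^ 2) (-(2 * decayRate μ ω (‖f x‖ ^ 2) * ‖f x‖ ^ 2)) x := by
  refine (hf.hasDerivAt x hx).norm_sq.congr_deriv ?_
  rw [inner_neg_right, inner_smul_right, real_inner_self_eq_norm_sq]
  ring

theorem normSq_le (hf : IsTail μ ω f) {x : ℝ} (hx : 0 ≤ x) : ‖f x‖ ^ 2 ≤ ‖f 0‖ ^ 2 := by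
  refine antitoneOn_of_deriv_nonpos (D := Ici 0) (f := fun x => ‖f x‖ ^ 2) (convex_Ici 0)
    (hf.continuousOn.norm.pow 2) ?_ ?_ self_mem_Ici hx hx
  · rw [interior_Ici]
    exact fun y hy => (hf.hasDerivAt_normSq hy).differentiableAt.differentiableWithinAt
  · rw [interior_Ici]
    intro y hy
    rw [(hf.hasDerivAt_normSq hy).deriv]
    have := decayRate_nonneg μ ω (‖f y‖ ^ 2)
    have : 0 ≤ 2 * decayRate μ ω (‖f y‖ ^ 2) * ‖f y‖ ^ 2 := by positivity
    linarith

theorem normSq_pos (hf : IsTail μ ω f) (hμ : 0 < μ) (h0 : 0 < ‖f 0‖) {x : ℝ} (hx : 0 ≤ x) :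
    0 < ‖f x‖ ^ 2 := by
  -- Since `k ≤ √ω`, the function `exp (2√ω x) |f|²` is nondecreasing.
  have hd : ∀ y, 0 < y → HasDerivAt (fun x => Real.exp (2 * √ω * x) * ‖f x‖ ^ 2)
      (Real.exp (2 * √ω * y) * (2 * √ω) * ‖f y‖ ^ 2 + Real.exp (2 * √ω * y) *
        (-(2 * decayRate μ ω (‖f y‖ ^ 2) * ‖f y‖ ^ 2))) y := fun y hy =>
    (by simpa using ((hasDerivAt_id y).const_mul (2 * √ω)).exp :
      HasDerivAt (fun x => Real.exp (2 * √ω * x)) (Real.exp (2 * √ω * y) * (2 * √ω)) y).mul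
        (hf.hasDerivAt_normSq hy)
  have hmono : MonotoneOn (fun x => Real.exp (2 * √ω * x) * ‖f x‖ ^ 2) (Ici 0) := by
    refine monotoneOn_of_deriv_nonneg (convex_Ici 0) ?_ ?_ ?_
    · exact ((by fun_prop : Continuous fun x => Real.exp (2 * √ω * x)).continuousOn).mul
        (hf.continuousOn.norm.pow 2)
    · rw [interior_Ici]
      exact fun y hy => (hd y hy).differentiableAt.differentiableWithinAt
    · rw [interior_Ici]
      intro y hy
      rw [(hd y hy).deriv]
      have h1 := sub_nonneg.2 (decayRate_le hμ ω (‖f y‖ ^ 2))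
      have : 0 ≤ Real.exp (2 * √ω * y) * 2 * ‖f y‖ ^ 2 * (√ω - decayRate μ ω (‖f y‖ ^ 2)) := by
        positivity
      linarith
  have h1 := hmono self_mem_Ici hx hx
  simp only [mul_zero, Real.exp_zero, one_mul] at h1
  have h2 : 0 < Real.exp (2 * √ω * x) * ‖f x‖ ^ 2 := lt_of_lt_of_le (by positivity) h1
  exact pos_of_mul_pos_right h2 (Real.exp_pos _).le

/-- Along a tail, `t = k(|f|²)` solves the Riccati equation `t' = μ (ω - t²)`. -/
theorem hasDerivAt_decayRate (hf : IsTail μ ω f) (hμ : 0 < μ) (h0 : 0 < ‖f 0‖)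
    (hω : (‖f 0‖ ^ 2) ^ μ / (μ + 1) < ω) {x : ℝ} (hx : 0 < x) :
    HasDerivAt (fun x => decayRate μ ω (‖f x‖ ^ 2))
      (μ * (ω - decayRate μ ω (‖f x‖ ^ 2) ^ 2)) x := by
  have hq := hf.normSq_pos hμ h0 hx.le
  have hμ1 : (0 : ℝ) < μ + 1 := by positivity
  have hpos : 0 < ω - (‖f x‖ ^ 2) ^ μ / (μ + 1) := by
    have : (‖f x‖ ^ 2) ^ μ / (μ + 1) ≤ (‖f 0‖ ^ 2) ^ μ / (μ + 1) := by
      have := Real.rpow_le_rpow hq.le (hf.normSq_le hx.le) hμ.le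
      gcongr
    linarith
  have hk : decayRate μ ω (‖f x‖ ^ 2) = √(ω - (‖f x‖ ^ 2) ^ μ / (μ + 1)) := by
    rw [decayRate, abs_of_pos hq]
  have hd := ((((hf.hasDerivAt_normSq hx).rpow_const (p := μ) (Or.inl hq.ne')).div_const
    (μ + 1)).const_sub ω).sqrt hpos.ne'
  have heq : (fun x => decayRate μ ω (‖f x‖ ^ 2)) =
      fun x => √(ω - (‖f x‖ ^ 2) ^ μ / (μ + 1)) := by
    ext y
    rw [decayRate, abs_of_nonneg (by positivity)]
  rw [heq]
  refine hd.congr_deriv ?_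
  rw [← hk]
  have hkpos : 0 < decayRate μ ω (‖f x‖ ^ 2) := hk ▸ Real.sqrt_pos.2 hpos
  have hk2 : decayRate μ ω (‖f x‖ ^ 2) ^ 2 = ω - (‖f x‖ ^ 2) ^ μ / (μ + 1) := by
    rw [hk, Real.sq_sqrt hpos.le]
  have e : (‖f x‖ ^ 2) ^ (μ - 1) * ‖f x‖ ^ 2 = (‖f x‖ ^ 2) ^ μ := by
    rw [← Real.rpow_add_one hq.ne', sub_add_cancel]
  rw [hk2, ← e]
  field_simp
  ring

/-- Two tails with the same modulus at the origin differ by a constant factor. -/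
theorem div_eq_div {f₁ f₂ : ℝ → ℂ} (h₁ : IsTail μ ω f₁) (h₂ : IsTail μ ω f₂) (hμ : 0 < μ)
    (h0 : 0 < ‖f₂ 0‖) (hω : (‖f₂ 0‖ ^ 2) ^ μ / (μ + 1) < ω) (heq : ‖f₁ 0‖ = ‖f₂ 0‖) {x : ℝ}
    (hx : 0 ≤ x) : f₁ x / f₂ x = f₁ 0 / f₂ 0 := by
  set t₁ : ℝ → ℝ := fun x => decayRate μ ω (‖f₁ x‖ ^ 2) with ht₁
  set t₂ : ℝ → ℝ := fun x => decayRate μ ω (‖f₂ x‖ ^ 2) with ht₂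
  have hd₁ : ∀ y, 0 < y → HasDerivAt t₁ (μ * (ω - t₁ y ^ 2)) y := fun y hy =>
    h₁.hasDerivAt_decayRate hμ (heq ▸ h0) (by rwa [heq]) hy
  have hd₂ : ∀ y, 0 < y → HasDerivAt t₂ (μ * (ω - t₂ y ^ 2)) y := fun y hy =>
    h₂.hasDerivAt_decayRate hμ h0 hω hy
  have hc : ∀ {g : ℝ → ℂ}, IsTail μ ω g →
      ContinuousOn (fun x => decayRate μ ω (‖g x‖ ^ 2)) (Ici 0) := fun hg =>
    (continuous_decayRate hμ ω).comp_continuousOn (hg.continuousOn.norm.pow 2)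
  have hanti : AntitoneOn (fun y => (t₁ y - t₂ y) ^ 2) (Ici 0) := by
    have hd : ∀ y, 0 < y → HasDerivAt (fun y => (t₁ y - t₂ y) ^ 2)
        (-(2 * μ * (t₁ y + t₂ y) * (t₁ y - t₂ y) ^ 2)) y := by
      intro y hy
      refine (((hd₁ y hy).sub (hd₂ y hy)).pow 2).congr_deriv ?_
      simp only [Pi.sub_apply]
      push_cast
      ring
    refine antitoneOn_of_deriv_nonpos (convex_Ici 0) (((hc h₁).sub (hc h₂)).pow 2) ?_ ?_
    · rw [interior_Ici]
      exact fun y hy => (hd y hy).differentiableAt.differentiableWithinAt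
    · rw [interior_Ici]
      intro y hy
      rw [(hd y hy).deriv, neg_nonpos]
      have a1 : 0 ≤ t₁ y := decayRate_nonneg _ _ _
      have a2 : 0 ≤ t₂ y := decayRate_nonneg _ _ _
      positivity
  have htt : ∀ y, 0 ≤ y → t₁ y = t₂ y := by
    intro y hy
    have h1 := hanti self_mem_Ici hy hy
    simp only [ht₁, ht₂, heq, sub_self] at h1
    have h2 : (t₁ y - t₂ y) ^ 2 ≤ 0 := by simpa using h1
    exact sub_eq_zero.1 (pow_eq_zero_iff two_ne_zero |>.1 (le_antisymm h2 (sq_nonneg _)))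
  have hne : ∀ y, 0 ≤ y → f₂ y ≠ 0 := fun y hy H => by
    have := h₂.normSq_pos hμ h0 hy
    simp [H] at this
  set r : ℝ → ℂ := fun y => f₁ y / f₂ y with hr
  have hrd : ∀ y, 0 < y → HasDerivAt r 0 y := by
    intro y hy
    refine ((h₁.hasDerivAt y hy).div (h₂.hasDerivAt y hy) (hne y hy.le)).congr_deriv ?_
    have : decayRate μ ω (‖f₁ y‖ ^ 2) = decayRate μ ω (‖f₂ y‖ ^ 2) := htt y hy.le
    rw [this]
    simp only [Complex.real_smul]
    rw [div_eq_zero_iff]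
    left
    ring
  have hrc : ContinuousOn r (Ici 0) :=
    h₁.continuousOn.div h₂.continuousOn fun y hy => hne y hy
  have hconst : ∀ y, 0 < y → r y = r (x + 1) := fun y hy =>
    isOpen_Ioi.is_const_of_deriv_eq_zero isPreconnected_Ioi
      (fun z hz => (hrd z hz).differentiableAt.differentiableWithinAt)
      (fun z hz => (hrd z hz).deriv) hy (by rw [mem_Ioi]; linarith)
  have hr0 : r 0 = r (x + 1) := by
    have h1 : Filter.Tendsto r (nhdsWithin 0 (Ioi 0)) (nhds (r 0)) :=
      (hrc 0 self_mem_Ici).mono_left (nhdsWithin_mono 0 Ioi_subset_Ici_self)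
    refine tendsto_nhds_unique h1 (tendsto_const_nhds.congr' ?_)
    filter_upwards [self_mem_nhdsWithin] with y hy using (hconst y hy).symm
  change r x = r 0
  rcases hx.eq_or_lt with rfl | hx'
  · rfl
  · rw [hconst x hx', hr0]

end IsTail

/-! ### Action and mass of the stationary tails -/

/-- The integral `∫_s^1 (1 - t²)^{1/μ} dt`, which gives the action of a tail. -/
noncomputable def actionIntegral (μ s : ℝ) : ℝ := ∫ t in s..1, (1 - t ^ 2) ^ (1 / μ)

/-- The integral `∫_s^1 (1 - t²)^{1/μ - 1} dt`, which gives the mass of a tail. It is expressed by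
`actionIntegral` through an integration by parts, since the integrand is singular at `1` for
`μ > 1`. -/
noncomputable def massIntegral (μ s : ℝ) : ℝ :=
  (1 + μ / 2) * actionIntegral μ s + μ / 2 * (s * (1 - s ^ 2) ^ (1 / μ))

/-- The action at frequency `ω` of the tail `f` with `f'(0) = -κ f(0)`, including the boundary term
`-κ |f(0)|² / 2`. -/
noncomputable def reducedAction (μ κ ω : ℝ) : ℝ :=
  1 / 2 * (√ω * ((μ + 1) * ω) ^ (1 / μ) * actionIntegral μ (κ / √ω))

/-- The mass of the tail `f` at frequency `ω` with `f'(0) = -κ f(0)`. -/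
noncomputable def tailMass (μ κ ω : ℝ) : ℝ :=
  ((μ + 1) * ω) ^ (1 / μ) / (μ * √ω) * massIntegral μ (κ / √ω)

theorem continuous_one_sub_sq_rpow {μ : ℝ} (hμ : 0 < μ) :
    Continuous fun t : ℝ => (1 - t ^ 2) ^ (1 / μ) :=
  (continuous_const.sub (continuous_pow 2)).rpow_const fun _ => Or.inr (by positivity)

theorem hasDerivAt_actionIntegral {μ : ℝ} (hμ : 0 < μ) (s : ℝ) :
    HasDerivAt (actionIntegral μ) (-(1 - s ^ 2) ^ (1 / μ)) s :=
  have hc := continuous_one_sub_sq_rpow hμ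
  intervalIntegral.integral_hasDerivAt_left (hc.intervalIntegrable _ _)
    (hc.stronglyMeasurableAtFilter _ _) hc.continuousAt

theorem continuous_massIntegral {μ : ℝ} (hμ : 0 < μ) : Continuous (massIntegral μ) :=
  (continuous_const.mul (continuous_iff_continuousAt.2 fun s =>
    (hasDerivAt_actionIntegral hμ s).continuousAt)).add
    (continuous_const.mul (continuous_id.mul (continuous_one_sub_sq_rpow hμ)))

theorem massIntegral_one {μ : ℝ} (hμ : 0 < μ) : massIntegral μ 1 = 0 := by
  have : (1 / μ) ≠ 0 := by positivity
  simp [massIntegral, actionIntegral, Real.zero_rpow (inv_ne_zero hμ.ne')]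

theorem hasDerivAt_one_sub_sq_rpow (μ : ℝ) {s : ℝ} (hs : 0 < 1 - s ^ 2) :
    HasDerivAt (fun t : ℝ => (1 - t ^ 2) ^ (1 / μ))
      (-(2 * s / μ) * (1 - s ^ 2) ^ (1 / μ - 1)) s := by
  have h1 : HasDerivAt (fun t : ℝ => 1 - t ^ 2) (-(2 * s)) s := by
    simpa using ((hasDerivAt_id s).pow 2).const_sub 1
  refine (h1.rpow_const (p := 1 / μ) (Or.inl hs.ne')).congr_deriv ?_
  ring

theorem hasDerivAt_massIntegral {μ s : ℝ} (hμ : 0 < μ) (hs : 0 < 1 - s ^ 2) :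
    HasDerivAt (massIntegral μ) (-(1 - s ^ 2) ^ (1 / μ - 1)) s := by
  have h2 := ((hasDerivAt_actionIntegral hμ s).const_mul (1 + μ / 2)).add
    (((hasDerivAt_id s).mul (hasDerivAt_one_sub_sq_rpow μ hs)).const_mul (μ / 2))
  refine h2.congr_deriv ?_
  have e : (1 - s ^ 2) ^ (1 / μ) = (1 - s ^ 2) ^ (1 / μ - 1) * (1 - s ^ 2) := by
    rw [← Real.rpow_add_one hs.ne', sub_add_cancel]
  simp only [id, e]
  field_simp
  ring

theorem strictAntiOn_massIntegral {μ : ℝ} (hμ : 0 < μ) :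
    StrictAntiOn (massIntegral μ) (Icc 0 1) := by
  refine strictAntiOn_of_deriv_neg (convex_Icc 0 1) (continuous_massIntegral hμ).continuousOn ?_
  rw [interior_Icc]
  intro s hs
  have h1 : 0 < 1 - s ^ 2 := by nlinarith [hs.1, hs.2]
  rw [(hasDerivAt_massIntegral hμ h1).deriv]
  exact neg_lt_zero.2 (Real.rpow_pos_of_pos h1 _)

theorem massIntegral_pos {μ s : ℝ} (hμ : 0 < μ) (h0 : 0 ≤ s) (h1 : s < 1) :
    0 < massIntegral μ s := by
  have := strictAntiOn_massIntegral hμ ⟨h0, h1.le⟩ ⟨zero_le_one, le_rfl⟩ h1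
  rwa [massIntegral_one hμ] at this

/-- Both sides are integrals of `√ω t` against `-d(σ/2)`, where `σ = |f|²` runs along the tail and
`t = tanh` is the Riccati variable, the right side after an integration by parts. -/
theorem tailAction_eq {μ ω s : ℝ} (hμ : 0 < μ) (hω : 0 < ω) (h0 : 0 < s) (h1 : s ≤ 1) :
    tailAction μ ω (((μ + 1) * ω) ^ (1 / μ) * (1 - s ^ 2) ^ (1 / μ)) =
      1 / 2 * (√ω * s) * (((μ + 1) * ω) ^ (1 / μ) * (1 - s ^ 2) ^ (1 / μ)) +
        1 / 2 * (√ω * ((μ + 1) * ω) ^ (1 / μ) * actionIntegral μ s) := by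
  set A := ((μ + 1) * ω) ^ (1 / μ) with hA
  have hμω : 0 < (μ + 1) * ω := by positivity
  have hA0 : 0 < A := Real.rpow_pos_of_pos hμω _
  set g : ℝ → ℝ := fun t => tailAction μ ω (A * (1 - t ^ 2) ^ (1 / μ))
    - 1 / 2 * (√ω * t) * (A * (1 - t ^ 2) ^ (1 / μ)) - 1 / 2 * (√ω * A * actionIntegral μ t) with hg
  have hHc : Continuous (tailAction μ ω) := continuous_iff_continuousAt.2 fun s =>
    (hasDerivAt_tailAction hμ ω s).continuousAt
  have hJc : Continuous (actionIntegral μ) := continuous_iff_continuousAt.2 fun s =>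
    (hasDerivAt_actionIntegral hμ s).continuousAt
  have hpc := continuous_one_sub_sq_rpow hμ
  have hgc : Continuous g := by
    have := hHc.comp (hpc.const_mul A)
    refine (this.sub ?_).sub ?_ <;> fun_prop
  have hrate : ∀ t, 0 ≤ t → t ≤ 1 → decayRate μ ω (A * (1 - t ^ 2) ^ (1 / μ)) = √ω * t := by
    intro t ht0 ht1
    have hnn : 0 ≤ 1 - t ^ 2 := by nlinarith
    rw [decayRate, abs_of_nonneg (by positivity), Real.mul_rpow hA0.le (by positivity), hA,
      ← Real.rpow_mul hμω.le, ← Real.rpow_mul hnn, one_div_mul_cancel hμ.ne', Real.rpow_one,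
      Real.rpow_one]
    have : ω - (μ + 1) * ω * (1 - t ^ 2) / (μ + 1) = ω * t ^ 2 := by
      have : μ + 1 ≠ 0 := by positivity
      field_simp
      ring
    rw [this, Real.sqrt_mul hω.le, Real.sqrt_sq ht0]
  have hgd : ∀ t ∈ Ico s 1, HasDerivAt g 0 t := by
    intro t ht
    have ht0 : 0 < t := h0.trans_le ht.1
    have hpos : 0 < 1 - t ^ 2 := by nlinarith [ht.2]
    have hp := hasDerivAt_one_sub_sq_rpow μ hpos
    have d1 := (hasDerivAt_tailAction hμ ω (A * (1 - t ^ 2) ^ (1 / μ))).comp t (hp.const_mul A)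
    have d2 := ((((hasDerivAt_id t).const_mul √ω).const_mul (1 / 2)).mul (hp.const_mul A))
    have d3 := ((hasDerivAt_actionIntegral hμ t).const_mul (√ω * A)).const_mul (1 / 2)
    refine ((d1.sub d2).sub d3).congr_deriv ?_
    rw [hrate t ht0.le ht.2.le]
    simp only [id]
    ring
  have hconst := constant_of_has_deriv_right_zero hgc.continuousOn
    (fun t ht => (hgd t ht).hasDerivWithinAt) 1 ⟨h1, le_rfl⟩
  have hg1 : g 1 = 0 := by
    simp [hg, actionIntegral, Real.zero_rpow (inv_ne_zero hμ.ne'), tailAction_zero]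
  rw [hg1] at hconst
  simp only [hg] at hconst
  linarith

theorem tailAction_sub_eq_reducedAction {μ κ ω : ℝ} (hμ : 0 < μ) (hκ : 0 < κ) (hω : κ ^ 2 < ω) :
    tailAction μ ω (((μ + 1) * (ω - κ ^ 2)) ^ (1 / μ))
      - κ / 2 * ((μ + 1) * (ω - κ ^ 2)) ^ (1 / μ) = reducedAction μ κ ω := by
  have hω0 : 0 < ω := (by positivity : 0 < κ ^ 2).trans hω
  have hs : 0 < √ω := Real.sqrt_pos.2 hω0
  have hlt : κ < √ω := Real.lt_sqrt_of_sq_lt hω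
  have e : ((μ + 1) * (ω - κ ^ 2)) ^ (1 / μ) =
      ((μ + 1) * ω) ^ (1 / μ) * (1 - (κ / √ω) ^ 2) ^ (1 / μ) := by
    rw [div_pow, Real.sq_sqrt hω0.le, ← Real.mul_rpow (by positivity)
      (sub_nonneg.2 ((div_le_one hω0).2 hω.le))]
    congr 1
    field_simp
  rw [e, tailAction_eq hμ hω0 (div_pos hκ hs) ((div_le_one hs).2 hlt.le), mul_div_cancel₀ _ hs.ne',
    reducedAction]
  ring

theorem hasDerivAt_reducedAction {μ κ ω : ℝ} (hμ : 0 < μ) (hω : 0 < ω) :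
    HasDerivAt (reducedAction μ κ) (tailMass μ κ ω / 2) ω := by
  have hs : 0 < √ω := Real.sqrt_pos.2 hω
  have hsq : √ω ^ 2 = ω := Real.sq_sqrt hω.le
  have hμω : 0 < (μ + 1) * ω := by positivity
  have d1 : HasDerivAt (fun x => √x) (1 / (2 * √ω)) ω := Real.hasDerivAt_sqrt hω.ne'
  have d2 : HasDerivAt (fun x => ((μ + 1) * x) ^ (1 / μ))
      (1 / μ * ((μ + 1) * ω) ^ (1 / μ) / ω) ω := by
    refine (((hasDerivAt_id ω).const_mul (μ + 1)).rpow_const (p := 1 / μ)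
      (Or.inl hμω.ne')).congr_deriv ?_
    have e : ((μ + 1) * ω) ^ (1 / μ) = ((μ + 1) * ω) ^ (1 / μ - 1) * ((μ + 1) * ω) := by
      rw [← Real.rpow_add_one hμω.ne', sub_add_cancel]
    rw [e]
    simp only [id]
    field_simp
  have d3 : HasDerivAt (fun x => κ / √x) (-(κ / (2 * √ω)) / ω) ω := by
    refine ((hasDerivAt_const ω κ).div d1 hs.ne').congr_deriv ?_
    rw [hsq]
    ring
  have d4 := (hasDerivAt_actionIntegral hμ (κ / √ω)).comp ω d3
  have d5 := ((d1.mul d2).mul d4).const_mul (1 / 2)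
  refine d5.congr_deriv ?_
  simp only [tailMass, massIntegral, Pi.mul_apply, Function.comp]
  set A := ((μ + 1) * ω) ^ (1 / μ)
  set X := (1 - (κ / √ω) ^ 2) ^ (1 / μ)
  set J := actionIntegral μ (κ / √ω)
  rw [← hsq, Real.sqrt_sq hs.le]
  field_simp
  ring

/-- The mass of the tails increases with the frequency. Subcriticality `μ < 2` enters only here. -/
theorem strictMonoOn_tailMass {μ κ : ℝ} (hμ : 0 < μ) (hμ2 : μ < 2) (hκ : 0 < κ) :
    StrictMonoOn (tailMass μ κ) (Ioi (κ ^ 2)) := by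
  have e : ∀ x, 0 < x → tailMass μ κ x =
      (μ + 1) ^ (1 / μ) / μ * (x ^ (1 / μ - 1 / 2) * massIntegral μ (κ / √x)) := by
    intro x hx
    rw [tailMass, Real.mul_rpow (by positivity) hx.le, Real.rpow_sub hx, ← Real.sqrt_eq_rpow]
    field_simp
  intro x hx y hy hxy
  rw [mem_Ioi] at hx hy
  have hx0 : 0 < x := (by positivity : 0 < κ ^ 2).trans hx
  have hy0 : 0 < y := hx0.trans hxy
  have hsx : 0 < √x := Real.sqrt_pos.2 hx0
  have hsy : 0 < √y := Real.sqrt_pos.2 hy0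
  rw [e x hx0, e y hy0]
  have h1 : x ^ (1 / μ - 1 / 2) < y ^ (1 / μ - 1 / 2) :=
    Real.rpow_lt_rpow hx0.le hxy (sub_pos.2 (one_div_lt_one_div_of_lt hμ hμ2))
  have hxm : κ / √x ∈ Icc (0 : ℝ) 1 :=
    ⟨by positivity, (div_le_one hsx).2 (Real.lt_sqrt_of_sq_lt hx).le⟩
  have hym : κ / √y ∈ Icc (0 : ℝ) 1 :=
    ⟨by positivity, (div_le_one hsy).2 (Real.lt_sqrt_of_sq_lt hy).le⟩
  have h2 : massIntegral μ (κ / √x) < massIntegral μ (κ / √y) :=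
    strictAntiOn_massIntegral hμ hym hxm
      (div_lt_div_of_pos_left hκ hsx (Real.sqrt_lt_sqrt hx0.le hxy))
  have h3 := massIntegral_pos hμ hxm.1 ((div_lt_one hsx).2 (Real.lt_sqrt_of_sq_lt hx))
  refine mul_lt_mul_of_pos_left ?_ (by positivity)
  exact mul_lt_mul'' h1 h2 (by positivity) h3.le

/-- The reduced action is strictly convex in the frequency: it lies above its tangents. -/
theorem reducedAction_tangent_lt {μ κ ω ω' : ℝ} (hμ : 0 < μ) (hμ2 : μ < 2) (hκ : 0 < κ)
    (hω : κ ^ 2 < ω) (hω' : κ ^ 2 < ω') (hne : ω' ≠ ω) :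
    reducedAction μ κ ω + (ω' - ω) * (tailMass μ κ ω / 2) < reducedAction μ κ ω' := by
  have hκ2 : 0 < κ ^ 2 := by positivity
  have hd : ∀ x, κ ^ 2 < x → HasDerivAt (reducedAction μ κ) (tailMass μ κ x / 2) x := fun x hx =>
    hasDerivAt_reducedAction hμ (hκ2.trans hx)
  have hconv : StrictConvexOn ℝ (Ioi (κ ^ 2)) (reducedAction μ κ) := by
    refine StrictMonoOn.strictConvexOn_of_deriv (convex_Ioi _)
      (fun x hx => (hd x hx).continuousAt.continuousWithinAt) ?_
    rw [interior_Ioi]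
    intro x hx y hy hxy
    rw [(hd x hx).deriv, (hd y hy).deriv]
    linarith [strictMonoOn_tailMass hμ hμ2 hκ hx hy hxy]
  rcases hne.lt_or_gt with h | h
  · have := hconv.slope_lt_of_hasDerivAt hω' hω h (hd ω hω)
    rw [slope_def_field, div_lt_iff₀ (sub_pos.2 h)] at this
    linarith
  · have := hconv.lt_slope_of_hasDerivAt hω hω' h (hd ω hω)
    rw [slope_def_field, lt_div_iff₀ (sub_pos.2 h)] at this
    linarith

/-! ### The soliton and its tails -/

theorem one_sub_tanh_sq (y : ℝ) : 1 - Real.tanh y ^ 2 = (1 / Real.cosh y) ^ 2 := by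
  have h := (Real.cosh_pos y).ne'
  rw [Real.tanh_eq_sinh_div_cosh]
  field_simp
  linarith [Real.cosh_sq y]

theorem hasDerivAt_tanh (y : ℝ) : HasDerivAt Real.tanh (1 - Real.tanh y ^ 2) y := by
  have h := (Real.cosh_pos y).ne'
  have h1 := (Real.hasDerivAt_sinh y).div (Real.hasDerivAt_cosh y) h
  refine (h1.congr_deriv ?_).congr_of_eventuallyEq
    (Filter.Eventually.of_forall fun z => Real.tanh_eq_sinh_div_cosh z)
  rw [Real.tanh_eq_sinh_div_cosh]
  field_simp

theorem continuous_tanh : Continuous Real.tanh :=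
  continuous_iff_continuousAt.2 fun y => (hasDerivAt_tanh y).continuousAt

theorem tendsto_tanh_atTop : Filter.Tendsto Real.tanh Filter.atTop (nhds 1) := by
  have h1 : Filter.Tendsto (fun y => 1 - Real.exp (-y)) Filter.atTop (nhds (1 - 0)) :=
    (Real.tendsto_exp_neg_atTop_nhds_zero).const_sub 1
  rw [sub_zero] at h1
  refine tendsto_of_tendsto_of_tendsto_of_le_of_le h1 tendsto_const_nhds (fun y => ?_)
    fun y => (Real.tanh_lt_one y).le
  have hc := Real.one_le_cosh y
  have e : Real.tanh y = 1 - Real.exp (-y) / Real.cosh y := by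
    rw [Real.tanh_eq_sinh_div_cosh, ← Real.cosh_sub_sinh]
    field_simp
    ring
  rw [e]
  have := div_le_self (Real.exp_pos (-y)).le hc
  dsimp only
  linarith

theorem soliton_pos {μ ω : ℝ} (hμ : 0 < μ) (hω : 0 < ω) (x : ℝ) : 0 < soliton μ ω x := by
  have := Real.cosh_pos (μ * √ω * x)
  unfold soliton
  positivity

theorem soliton_sq {μ ω : ℝ} (hμ : 0 < μ) (hω : 0 < ω) (x : ℝ) :
    soliton μ ω x ^ 2 =
      ((μ + 1) * ω) ^ (1 / μ) * (1 - Real.tanh (μ * √ω * x) ^ 2) ^ (1 / μ) := by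
  have hc : 0 < 1 / Real.cosh (μ * √ω * x) := one_div_pos.2 (Real.cosh_pos _)
  rw [soliton, mul_pow, one_sub_tanh_sq]
  congr 1
  · rw [← Real.rpow_natCast, ← Real.rpow_mul (by positivity)]
    congr 1
    push_cast
    field_simp
  · rw [← Real.rpow_natCast, ← Real.rpow_natCast, ← Real.rpow_mul hc.le, ← Real.rpow_mul hc.le,
      mul_comm (1 / μ)]

theorem soliton_sq_rpow {μ ω : ℝ} (hμ : 0 < μ) (hω : 0 < ω) (x : ℝ) :
    (soliton μ ω x ^ 2) ^ μ = (μ + 1) * ω * (1 - Real.tanh (μ * √ω * x) ^ 2) := by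
  have h1 : 0 ≤ 1 - Real.tanh (μ * √ω * x) ^ 2 := sub_nonneg.2 (Real.tanh_sq_lt_one _).le
  have h2 : 0 ≤ (μ + 1) * ω := by positivity
  rw [soliton_sq hμ hω, Real.mul_rpow (by positivity) (by positivity), ← Real.rpow_mul h1,
    ← Real.rpow_mul h2, one_div_mul_cancel hμ.ne', Real.rpow_one, Real.rpow_one]

theorem hasDerivAt_soliton {μ ω : ℝ} (hμ : 0 < μ) (x : ℝ) :
    HasDerivAt (soliton μ ω) (-(√ω * Real.tanh (μ * √ω * x) * soliton μ ω x)) x := by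
  have hc := Real.cosh_pos (μ * √ω * x)
  have hc' : 0 < 1 / Real.cosh (μ * √ω * x) := one_div_pos.2 hc
  have d1 : HasDerivAt (fun x => Real.cosh (μ * √ω * x))
      (Real.sinh (μ * √ω * x) * (μ * √ω)) x := by
    simpa using ((hasDerivAt_id x).const_mul (μ * √ω)).cosh
  have d2 : HasDerivAt (fun x => 1 / Real.cosh (μ * √ω * x))
      (-(Real.sinh (μ * √ω * x) * (μ * √ω)) / Real.cosh (μ * √ω * x) ^ 2) x := by
    simp only [one_div]
    exact d1.inv hc.ne'
  have d3 := (d2.rpow_const (p := 1 / μ) (Or.inl hc'.ne')).const_mul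
    (((μ + 1) * ω) ^ (1 / (2 * μ)))
  refine d3.congr_deriv ?_
  have e : (1 / Real.cosh (μ * √ω * x)) ^ (1 / μ) =
      (1 / Real.cosh (μ * √ω * x)) ^ (1 / μ - 1) * (1 / Real.cosh (μ * √ω * x)) := by
    rw [← Real.rpow_add_one hc'.ne', sub_add_cancel]
  rw [soliton, e, Real.tanh_eq_sinh_div_cosh]
  field_simp

theorem decayRate_soliton {μ ω x : ℝ} (hμ : 0 < μ) (hω : 0 < ω) (hx : 0 ≤ x) :
    decayRate μ ω (soliton μ ω x ^ 2) = √ω * Real.tanh (μ * √ω * x) := by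
  have ht : 0 ≤ Real.tanh (μ * √ω * x) := by
    rw [Real.tanh_eq_sinh_div_cosh]
    exact div_nonneg (Real.sinh_nonneg_iff.2 (by positivity)) (Real.cosh_pos _).le
  rw [decayRate, abs_of_nonneg (by positivity), soliton_sq_rpow hμ hω]
  have : ω - (μ + 1) * ω * (1 - Real.tanh (μ * √ω * x) ^ 2) / (μ + 1) =
      ω * Real.tanh (μ * √ω * x) ^ 2 := by
    have : μ + 1 ≠ 0 := by positivity
    field_simp
    ring
  rw [this, Real.sqrt_mul hω.le, Real.sqrt_sq ht]

theorem integrableOn_soliton_sq {μ ω : ℝ} (hμ : 0 < μ) (hω : 0 < ω) (z : ℝ) :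
    IntegrableOn (fun x => soliton μ ω (x + z) ^ 2) (Ioi 0) ∧
      ∫ x in Ioi (0 : ℝ), soliton μ ω (x + z) ^ 2 =
        ((μ + 1) * ω) ^ (1 / μ) / (μ * √ω) * massIntegral μ (Real.tanh (μ * √ω * z)) := by
  have hs : 0 < √ω := Real.sqrt_pos.2 hω
  set A := ((μ + 1) * ω) ^ (1 / μ) / (μ * √ω) with hA
  set F : ℝ → ℝ := fun x => -(A * massIntegral μ (Real.tanh (μ * √ω * (x + z)))) with hF
  have hd : ∀ x, HasDerivAt F (soliton μ ω (x + z) ^ 2) x := by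
    intro x
    have hpos : 0 < 1 - Real.tanh (μ * √ω * (x + z)) ^ 2 := sub_pos.2 (Real.tanh_sq_lt_one _)
    have d1 : HasDerivAt (fun x => μ * √ω * (x + z)) (μ * √ω) x := by
      simpa using ((hasDerivAt_id x).add_const z).const_mul (μ * √ω)
    have d2 := (((hasDerivAt_massIntegral hμ hpos).comp x
      ((hasDerivAt_tanh (μ * √ω * (x + z))).comp x d1)).const_mul A).neg
    refine d2.congr_deriv ?_
    have e : (1 - Real.tanh (μ * √ω * (x + z)) ^ 2) ^ (1 / μ) =
        (1 - Real.tanh (μ * √ω * (x + z)) ^ 2) ^ (1 / μ - 1) *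
          (1 - Real.tanh (μ * √ω * (x + z)) ^ 2) := by
      rw [← Real.rpow_add_one hpos.ne', sub_add_cancel]
    rw [soliton_sq hμ hω, e, hA]
    field_simp
  have hlim : Filter.Tendsto F Filter.atTop (nhds 0) := by
    have h1 : Filter.Tendsto (fun x => μ * √ω * (x + z)) Filter.atTop Filter.atTop :=
      (Filter.tendsto_atTop_add_const_right _ z Filter.tendsto_id).const_mul_atTop (by positivity)
    have h2 := (((continuous_massIntegral hμ).tendsto 1).comp
      (tendsto_tanh_atTop.comp h1)).const_mul A |>.neg
    rw [massIntegral_one hμ, mul_zero, neg_zero] at h2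
    exact h2
  have hnn : ∀ x ∈ Ioi (0 : ℝ), 0 ≤ soliton μ ω (x + z) ^ 2 := fun x _ => sq_nonneg _
  refine ⟨integrableOn_Ioi_deriv_of_nonneg' (fun x _ => hd x) hnn hlim, ?_⟩
  rw [integral_Ioi_of_hasDerivAt_of_nonneg' (fun x _ => hd x) hnn hlim]
  simp [hF]

/-- The half-soliton `x ↦ φ_ω(x + z)`, as a complex function. -/
noncomputable def solitonTail (μ ω z x : ℝ) : ℂ := (soliton μ ω (x + z) : ℂ)

section

variable {μ ω z : ℝ}

theorem norm_solitonTail (hμ : 0 < μ) (hω : 0 < ω) (x : ℝ) :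
    ‖solitonTail μ ω z x‖ = soliton μ ω (x + z) := by
  rw [solitonTail, Complex.norm_real, Real.norm_of_nonneg (soliton_pos hμ hω _).le]

theorem hasDerivAt_solitonTail (hμ : 0 < μ) (x : ℝ) :
    HasDerivAt (solitonTail μ ω z)
      (-((√ω * Real.tanh (μ * √ω * (x + z))) • solitonTail μ ω z x)) x := by
  have h1 := ((hasDerivAt_soliton (ω := ω) hμ (x + z)).comp_add_const x z).ofReal_comp
  refine h1.congr_deriv ?_
  simp [solitonTail]

theorem continuous_solitonTail (hμ : 0 < μ) : Continuous (solitonTail μ ω z) :=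
  continuous_iff_continuousAt.2 fun x => (hasDerivAt_solitonTail hμ x).continuousAt

theorem memLp_solitonTail (hμ : 0 < μ) (hω : 0 < ω) :
    MemLp (solitonTail μ ω z) 2 (volume.restrict (Ioi 0)) := by
  refine (memLp_two_iff_integrable_sq_norm
    (continuous_solitonTail hμ).aestronglyMeasurable).2 ?_
  simp only [norm_solitonTail hμ hω]
  exact (integrableOn_soliton_sq hμ hω z).1

theorem continuous_deriv_solitonTail (hμ : 0 < μ) : Continuous fun x =>
    -((√ω * Real.tanh (μ * √ω * (x + z))) • solitonTail μ ω z x) :=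
  ((continuous_const.mul (continuous_tanh.comp (by fun_prop))).smul
    (continuous_solitonTail hμ)).neg

theorem memLp_deriv_solitonTail (hμ : 0 < μ) (hω : 0 < ω) :
    MemLp (fun x => -((√ω * Real.tanh (μ * √ω * (x + z))) • solitonTail μ ω z x)) 2
      (volume.restrict (Ioi 0)) := by
  refine ((memLp_solitonTail (z := z) hμ hω).const_mul (√ω : ℂ)).mono
    (continuous_deriv_solitonTail hμ).aestronglyMeasurable
    (Filter.Eventually.of_forall fun x => ?_)
  rw [norm_neg, norm_smul, norm_mul, norm_mul, Complex.norm_real, Real.norm_eq_abs (Real.tanh _)]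
  have := (Real.abs_tanh_lt_one (μ * √ω * (x + z))).le
  exact mul_le_mul_of_nonneg_right (mul_le_of_le_one_right (norm_nonneg _) this) (norm_nonneg _)

theorem memH1_solitonTail (hμ : 0 < μ) (hω : 0 < ω) : MemH1 (solitonTail μ ω z) where
  continuousOn := (continuous_solitonTail hμ).continuousOn
  memLp := memLp_solitonTail hμ hω
  exists_weakDeriv := ⟨_, memLp_deriv_solitonTail hμ hω,
    isWeakDeriv_of_hasDerivAt (fun x => hasDerivAt_solitonTail hμ x)
      (continuous_deriv_solitonTail hμ)⟩

/-- For `0 ≤ z` the tail lies on the decreasing side of the soliton. -/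
theorem isTail_solitonTail (hμ : 0 < μ) (hω : 0 < ω) (hz : 0 ≤ z) :
    IsTail μ ω (solitonTail μ ω z) where
  continuousOn := (continuous_solitonTail hμ).continuousOn
  hasDerivAt x hx := by
    rw [norm_solitonTail hμ hω, decayRate_soliton hμ hω (by linarith)]
    exact hasDerivAt_solitonTail hμ x

/-- The half-soliton attains the least action for its value at the origin. -/
theorem action_solitonTail (hμ : 0 < μ) (hω : 0 < ω) (hz : 0 ≤ z) :
    1 / 2 * (∫ x in Ioi (0 : ℝ), ‖weakDeriv (solitonTail μ ω z) x‖ ^ 2)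
        - 1 / (2 * μ + 2) * (∫ x in Ioi (0 : ℝ), ‖solitonTail μ ω z x‖ ^ (2 * μ + 2))
        + ω / 2 * (∫ x in Ioi (0 : ℝ), ‖solitonTail μ ω z x‖ ^ 2) =
      tailAction μ ω (‖solitonTail μ ω z 0‖ ^ 2) := by
  have hf := memH1_solitonTail (z := z) hμ hω
  have hae := hf.isWeakDeriv.ae_eq (isWeakDeriv_of_hasDerivAt
    (fun x => hasDerivAt_solitonTail hμ x) (continuous_deriv_solitonTail hμ))
    hf.memLp_weakDeriv (memLp_deriv_solitonTail hμ hω)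
  rw [hf.action_eq hμ fun x _ => ?_]
  · have h0 : ∫ x in Ioi (0 : ℝ), ‖weakDeriv (solitonTail μ ω z) x +
        decayRate μ ω (‖solitonTail μ ω z x‖ ^ 2) • solitonTail μ ω z x‖ ^ 2 = 0 := by
      refine integral_eq_zero_of_ae ?_
      filter_upwards [hae, ae_restrict_mem measurableSet_Ioi] with x hx hx0
      rw [hx, norm_solitonTail hμ hω, decayRate_soliton hμ hω (by
        have : (0 : ℝ) < x := hx0
        linarith)]
      simp
    rw [h0]
    ring
  · rw [norm_solitonTail hμ hω, soliton_sq_rpow hμ hω]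
    have : 0 ≤ (μ + 1) * ω := by positivity
    nlinarith [sq_nonneg (Real.tanh (μ * √ω * (x + z)))]

end

/-! ### The energy on the star graph -/

theorem energy_add_mass_eq {N : ℕ} [NeZero N] (μ α ω : ℝ) (Φ : Fin N → ℝ → ℂ) :
    energy μ α Φ + ω / 2 * mass Φ =
      (∑ j, (1 / 2 * (∫ x in Ioi (0 : ℝ), ‖weakDeriv (Φ j) x‖ ^ 2)
        - 1 / (2 * μ + 2) * (∫ x in Ioi (0 : ℝ), ‖Φ j x‖ ^ (2 * μ + 2))
        + ω / 2 * (∫ x in Ioi (0 : ℝ), ‖Φ j x‖ ^ 2))) - α / 2 * ‖vertexValue Φ‖ ^ 2 := by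
  rw [Finset.sum_add_distrib, Finset.sum_sub_distrib, ← Finset.mul_sum, ← Finset.mul_sum,
    ← Finset.mul_sum, energy, mass]
  ring

/-- The energy of a state whose components lie below the maximum `((μ + 1) ω)^{1/(2μ)}` of the
soliton `φ_ω`. If `ω` is the frequency at which the half-soliton with `f'(0) = -κ f(0)` has the
vertex value of `Φ` in modulus, only a sum of squares and a function of `ω` remain. -/
theorem energy_add_mass_eq_reducedAction {N : ℕ} [NeZero N] {μ κ α ω : ℝ} (hμ : 0 < μ)
    (hκ : 0 < κ) (hα : α = N * κ) {Φ : Fin N → ℝ → ℂ} (hΦ : MemH1Graph Φ) (hω : κ ^ 2 < ω)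
    (hv : (‖vertexValue Φ‖ ^ 2) ^ μ = (μ + 1) * (ω - κ ^ 2))
    (hb : ∀ j x, 0 < x → (‖Φ j x‖ ^ 2) ^ μ ≤ (μ + 1) * ω) :
    energy μ α Φ + ω / 2 * mass Φ = N * reducedAction μ κ ω +
      ∑ j, 1 / 2 * ∫ x in Ioi (0 : ℝ),
        ‖weakDeriv (Φ j) x + decayRate μ ω (‖Φ j x‖ ^ 2) • Φ j x‖ ^ 2 := by
  have hsq : ‖vertexValue Φ‖ ^ 2 = ((μ + 1) * (ω - κ ^ 2)) ^ (1 / μ) := by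
    rw [← hv, ← Real.rpow_mul (by positivity), mul_one_div_cancel hμ.ne', Real.rpow_one]
  have h0 : ∀ j, Φ j 0 = vertexValue Φ := fun j => hΦ.continuous_vertex j 0
  rw [energy_add_mass_eq, ← tailAction_sub_eq_reducedAction hμ hκ hω, ← hsq,
    Finset.sum_congr rfl fun j _ => (hΦ.memH1 j).action_eq hμ (hb j), Finset.sum_add_distrib]
  simp only [h0]
  rw [Finset.sum_const, Finset.card_univ, Fintype.card_fin, nsmul_eq_mul, hα]
  ring

theorem norm_apply_le_h1Norm {N : ℕ} {Φ : Fin N → ℝ → ℂ} {j : Fin N} (hΦ : MemH1 (Φ j)) {x : ℝ}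
    (hx : 0 ≤ x) : ‖Φ j x‖ ≤ h1Norm Φ := by
  refine Real.le_sqrt_of_sq_le ((hΦ.norm_sq_le hx).trans ?_)
  exact Finset.single_le_sum (f := fun j => (∫ x in Ioi (0 : ℝ), ‖Φ j x‖ ^ 2) +
    ∫ x in Ioi (0 : ℝ), ‖weakDeriv (Φ j) x‖ ^ 2)
    (fun i _ => add_nonneg (integral_nonneg fun _ => sq_nonneg _)
      (integral_nonneg fun _ => sq_nonneg _)) (Finset.mem_univ j)

end StarGraph

open StarGraph in
theorem mainTheorem2 (N : ℕ) [NeZero N] (hN : 3 ≤ N) (μ α ω : ℝ)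
    (hμ0 : 0 < μ) (hμ2 : μ < 2) (hα : 0 < α) (hω : α ^ 2 / (N : ℝ) ^ 2 < ω)
    (M : ℝ) (hM : M = StarGraph.mass (StarGraph.Psi N μ α ω)) :
    StarGraph.Psi N μ α ω ∈ StarGraph.H1M N M ∧
    ∃ δ : ℝ, 0 < δ ∧ ∀ Φ ∈ StarGraph.H1M N M,
      (∃ θ : ℝ, StarGraph.h1Norm (Φ - StarGraph.phase θ (StarGraph.Psi N μ α ω)) < δ) →
      (¬ ∃ θ : ℝ, ∀ j, Set.EqOn (Φ j) (StarGraph.phase θ (StarGraph.Psi N μ α ω) j) (Set.Ici 0)) →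
      StarGraph.energy μ α (StarGraph.Psi N μ α ω) < StarGraph.energy μ α Φ := by
  have hN0 : (0 : ℝ) < N := by exact_mod_cast (by omega : 0 < N)
  set κ : ℝ := α / N with hκdef
  have hκ : 0 < κ := div_pos hα hN0
  have hακ : α = N * κ := by rw [hκdef]; field_simp
  rw [← div_pow] at hω
  change κ ^ 2 < ω at hω
  have hω0 : 0 < ω := (by positivity : 0 < κ ^ 2).trans hω
  have hs : 0 < √ω := Real.sqrt_pos.2 hω0
  have hμ1 : 0 < μ + 1 := by positivity
  set z := zeta N μ α ω with hz
  set ψ : ℝ → ℂ := solitonTail μ ω z with hψ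
  have hPsi : Psi N μ α ω = fun _ => ψ := rfl
  have hquot : α / (N * √ω) = κ / √ω := by rw [hκdef, div_div]
  have hmem : κ / √ω ∈ Ioo (0 : ℝ) 1 :=
    ⟨by positivity, (div_lt_one hs).2 (Real.lt_sqrt_of_sq_lt hω)⟩
  have hz0 : 0 ≤ z := by
    rw [hz, zeta, hquot]
    have := Real.artanh_nonneg hmem.1.le
    positivity
  have htanh : Real.tanh (μ * √ω * z) = κ / √ω := by
    rw [hz, zeta, ← mul_assoc, mul_one_div_cancel (by positivity), one_mul, hquot,
      Real.tanh_artanh ⟨by linarith [hmem.1], hmem.2⟩]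
  have hψH1 : MemH1 ψ := memH1_solitonTail hμ0 hω0
  have hψtail : IsTail μ ω ψ := isTail_solitonTail hμ0 hω0 hz0
  have hΨG : MemH1Graph (Psi N μ α ω) := ⟨fun _ => hψH1, fun _ _ => rfl⟩
  have hψ0 : 0 < ‖ψ 0‖ := by
    rw [hψ, norm_solitonTail hμ0 hω0]
    exact soliton_pos hμ0 hω0 _
  have hψv : (‖ψ 0‖ ^ 2) ^ μ = (μ + 1) * (ω - κ ^ 2) := by
    rw [hψ, norm_solitonTail hμ0 hω0, soliton_sq_rpow hμ0 hω0, zero_add, htanh, div_pow,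
      Real.sq_sqrt hω0.le]
    field_simp
  have hMval : M = N * tailMass μ κ ω := by
    rw [hM, hPsi, mass]
    simp only [hψ, norm_solitonTail hμ0 hω0]
    rw [(integrableOn_soliton_sq hμ0 hω0 z).2, htanh]
    simp [tailMass]
  have hEΨ : energy μ α (Psi N μ α ω) + ω / 2 * M = N * reducedAction μ κ ω := by
    have hsq : ‖ψ 0‖ ^ 2 = ((μ + 1) * (ω - κ ^ 2)) ^ (1 / μ) := by
      rw [← hψv, ← Real.rpow_mul (by positivity), mul_one_div_cancel hμ0.ne', Real.rpow_one]
    rw [hM, energy_add_mass_eq, ← tailAction_sub_eq_reducedAction hμ0 hκ hω, ← hsq, hPsi,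
      Finset.sum_const, Finset.card_univ, Fintype.card_fin, nsmul_eq_mul,
      action_solitonTail hμ0 hω0 hz0, hακ]
    simp only [vertexValue]
    ring
  refine ⟨⟨hΨG, hM.symm⟩, ?_⟩
  -- If `|Φ - e^{iθ} Ψ| ≤ δ` pointwise, then at the frequency `ω'` selected by the vertex value of
  -- `Φ` every component of `Φ` stays below the top of the soliton `φ_ω'`.
  obtain ⟨δ, hδ0, hδψ, hδ⟩ : ∃ δ : ℝ, 0 < δ ∧ δ < ‖ψ 0‖ ∧
      ((‖ψ 0‖ + δ) ^ 2) ^ μ < (μ + 1) * κ ^ 2 + ((‖ψ 0‖ - δ) ^ 2) ^ μ := by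
    have hc : Continuous fun δ : ℝ =>
        (μ + 1) * κ ^ 2 + ((‖ψ 0‖ - δ) ^ 2) ^ μ - ((‖ψ 0‖ + δ) ^ 2) ^ μ :=
      (continuous_const.add (((continuous_const.sub continuous_id).pow 2).rpow_const
        fun _ => Or.inr hμ0.le)).sub (((continuous_const.add continuous_id).pow 2).rpow_const
        fun _ => Or.inr hμ0.le)
    have h0 : 0 < (μ + 1) * κ ^ 2 + ((‖ψ 0‖ - 0) ^ 2) ^ μ - ((‖ψ 0‖ + 0) ^ 2) ^ μ := by
      rw [sub_zero, add_zero, add_sub_cancel_right]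
      positivity
    have hev : ∀ᶠ δ in nhdsWithin (0 : ℝ) (Ioi 0), 0 < (μ + 1) * κ ^ 2 +
        ((‖ψ 0‖ - δ) ^ 2) ^ μ - ((‖ψ 0‖ + δ) ^ 2) ^ μ :=
      nhdsWithin_le_nhds (hc.continuousAt.eventually_const_lt h0)
    have hev2 : ∀ᶠ δ in nhdsWithin (0 : ℝ) (Ioi 0), δ < ‖ψ 0‖ :=
      nhdsWithin_le_nhds (Iio_mem_nhds hψ0)
    obtain ⟨δ, h1, h2, h3⟩ := (hev.and (hev2.and self_mem_nhdsWithin)).exists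
    exact ⟨δ, h3, h2, by linarith⟩
  refine ⟨δ, hδ0, fun Φ hΦ hclose hne => ?_⟩
  obtain ⟨hΦG, hΦM⟩ := hΦ
  obtain ⟨θ, hθ⟩ := hclose
  have hpt : ∀ j x, 0 ≤ x → ‖Φ j x - Complex.exp (θ * Complex.I) * ψ x‖ < δ := fun j x hx =>
    (norm_apply_le_h1Norm (Φ := Φ - phase θ (Psi N μ α ω)) (j := j)
      ((hΦG.memH1 j).sub_const_mul (Complex.exp (θ * Complex.I)) hψH1) hx).trans_lt hθ
  have hexp : ∀ x, ‖Complex.exp (θ * Complex.I) * ψ x‖ = ‖ψ x‖ := fun x => by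
    rw [norm_mul, Complex.norm_exp_ofReal_mul_I, one_mul]
  have hupper : ∀ j x, 0 ≤ x → ‖Φ j x‖ ≤ ‖ψ 0‖ + δ := by
    intro j x hx
    have h1 := norm_sub_norm_le (Φ j x) (Complex.exp (θ * Complex.I) * ψ x)
    have h2 : ‖ψ x‖ ≤ ‖ψ 0‖ :=
      (pow_le_pow_iff_left₀ (norm_nonneg _) (norm_nonneg _) two_ne_zero).1 (hψtail.normSq_le hx)
    rw [hexp] at h1
    linarith [hpt j x hx]
  set a := ‖vertexValue Φ‖ with ha
  have hlower : ‖ψ 0‖ - δ < a := by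
    have h1 := norm_sub_norm_le (Complex.exp (θ * Complex.I) * ψ 0) (Φ 0 0)
    rw [hexp, norm_sub_rev] at h1
    have := hpt 0 0 le_rfl
    change ‖ψ 0‖ - a ≤ _ at h1
    linarith
  have ha0 : 0 < a := by linarith
  have haμ : 0 < (a ^ 2) ^ μ := by positivity
  set ω' := κ ^ 2 + (a ^ 2) ^ μ / (μ + 1) with hω'def
  have hω' : κ ^ 2 < ω' := lt_add_of_pos_right _ (by positivity)
  have hv : (a ^ 2) ^ μ = (μ + 1) * (ω' - κ ^ 2) := by
    rw [hω'def]
    field_simp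
    ring
  have hb : ∀ j x, 0 < x → (‖Φ j x‖ ^ 2) ^ μ ≤ (μ + 1) * ω' := by
    intro j x hx
    have h1 : (‖Φ j x‖ ^ 2) ^ μ ≤ ((‖ψ 0‖ + δ) ^ 2) ^ μ := by
      have := hupper j x hx.le
      gcongr
    have h2 : ((‖ψ 0‖ - δ) ^ 2) ^ μ ≤ (a ^ 2) ^ μ := by
      have : 0 ≤ ‖ψ 0‖ - δ := by linarith
      gcongr
    linarith
  have hE := energy_add_mass_eq_reducedAction hμ0 hκ hακ hΦG hω' hv hb
  rw [hΦM] at hE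
  have hterm : ∀ j, 0 ≤ 1 / 2 * ∫ x in Ioi (0 : ℝ),
      ‖weakDeriv (Φ j) x + decayRate μ ω' (‖Φ j x‖ ^ 2) • Φ j x‖ ^ 2 := fun j =>
    mul_nonneg (by norm_num) (integral_nonneg fun _ => sq_nonneg _)
  have hsum := Finset.sum_nonneg fun j (_ : j ∈ Finset.univ) => hterm j
  -- Only for `ω' = ω`, that is `|Φ(v)| = Ψ_ω(v)`, is the sum of squares needed for strictness.
  by_cases hωω : ω' = ω
  · rw [hωω] at hE hterm hsum hv
    by_contra hcon
    have hzero := (Finset.sum_eq_zero_iff_of_nonneg fun j _ => hterm j).1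
      (le_antisymm (by linarith) hsum)
    have haψ : a = ‖ψ 0‖ := by
      have h1 : a ^ 2 = ‖ψ 0‖ ^ 2 :=
        (Real.rpow_left_inj (by positivity) (by positivity) hμ0.ne').1 (hv.trans hψv.symm)
      exact (pow_left_inj₀ ha0.le hψ0.le two_ne_zero).1 h1
    refine hne ⟨Complex.arg (vertexValue Φ), fun j x hx => ?_⟩
    have hj := hΦG.memH1 j
    have htail : IsTail μ ω (Φ j) := by
      refine hj.isTail hμ0 ?_
      have h1 := hzero j (Finset.mem_univ j)
      have h2 : ∫ x in Ioi (0 : ℝ),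
          ‖weakDeriv (Φ j) x + decayRate μ ω (‖Φ j x‖ ^ 2) • Φ j x‖ ^ 2 = 0 := by linarith
      have h3 := (integral_eq_zero_iff_of_nonneg (fun _ => sq_nonneg _)
        (integrable_norm_sq_of_memLp (hj.memLp_weakDeriv.add
          (hj.memLp_decayRate_mul hμ0 ω)))).1 h2
      filter_upwards [h3] with x hx
      simpa using hx
    have hΦ0 : Φ j 0 = vertexValue Φ := hΦG.continuous_vertex j 0
    have hψreal : ψ 0 = (‖ψ 0‖ : ℂ) := by
      rw [hψ, norm_solitonTail hμ0 hω0]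
      rfl
    have hψx : ψ x ≠ 0 := fun H => by
      have := hψtail.normSq_pos hμ0 hψ0 hx
      simp [H] at this
    have hdiv := htail.div_eq_div hψtail hμ0 hψ0 (by
      rw [hψv, mul_div_cancel_left₀ _ hμ1.ne']
      linarith [(by positivity : 0 < κ ^ 2)]) (by rw [hΦ0, ← haψ]) hx
    have hpolar : vertexValue Φ =
        ‖ψ 0‖ * Complex.exp (Complex.arg (vertexValue Φ) * Complex.I) := by
      rw [← haψ, ha]
      exact (Complex.norm_mul_exp_arg_mul_I _).symm
    have hψ0c : (‖ψ 0‖ : ℂ) ≠ 0 := by exact_mod_cast hψ0.ne'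
    rw [hΦ0, hψreal, hpolar, mul_div_cancel_left₀ _ hψ0c, div_eq_iff hψx] at hdiv
    exact hdiv
  · have h1 := reducedAction_tangent_lt hμ0 hμ2 hκ hω hω' hωω
    have h2 := mul_lt_mul_of_pos_left h1 hN0
    have h3 : (N : ℝ) * ((ω' - ω) * (tailMass μ κ ω / 2)) = (ω' - ω) / 2 * M := by
      rw [hMval]
      ring
    rw [mul_add, h3] at h2
    linarith
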